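/- **Setting.** Let $\mathsf S\subset\mathbb R^{d_{\mathsf S}}$ and $\mathsf A\subset\mathbb R^{d_{\mathsf A}}$ be compact, let $H\in\mathbb N$, and consider the Markov decision process with measurable transition functions $P_h(\cdot\mid x,a)$ on $\mathsf S$ ($1\le h\le H$, $x\in\mathsf S$, $a\in\mathsf A$), measurable rewards $R_h:\mathsf S\times\mathsf A\to\mathbb R$ ($0\le h<H$) and measurable terminal reward $F:\mathsf S\to\mathbb R$. Let $$V_0^\star(x_0)=\sup_{\boldsymbol\pi}\mathbb E_{\boldsymbol\pi,x_0}\Big[\sum_{t=0}^{H-1}R_t(S_t,A_t)+F(S_H)\Big],$$ where the supremum is over all policies $\boldsymbol\pi=(\pi_0,\dots,\pi_{H-1})$ of measurable maps $\pi_t$ from $\mathsf S$ to the probability measures on $\mathsf A$, and under $\mathbb E_{\boldsymbol\pi,x_0}$ one has $S_0=x_0$, $A_t\sim\pi_t(S_t)$, $S_{t+1}\sim P_{t+1}(\cdot\mid S_t,A_t)$. Assume that $P_h(\cdot\mid x,a)$ has a Lebesgue density $p_h^a(\cdot\mid x)$ on $\mathsf S$ and that there are constants $\delta,\Lambda>0$,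 $L,G\ge 0$ and a function $\mathcal L:\mathsf S\to\mathbb R_+$ with $\max\{\|\mathcal L\|_{L^1(\mathsf S)},\|\mathcal L\|_{L^\infty(\mathsf S)}\}\le L$ such that $$\delta\le p_h^a(y\mid x)\le\Lambda,\qquad |p_h^{a_1}(y\mid x_1)-p_h^{a_2}(y\mid x_2)|\le\mathcal L(y)\,(|x_1-x_2|+|a_1-a_2|)$$ for all $x,x_1,x_2,y\in\mathsf S$, $a,a_1,a_2\in\mathsf A$, $1\le h\le H$, and $|R_h|\le G$ ($0\le h<H$), $|F|\le G$. **Algorithm.** Fix $x_0\in\mathsf S$ and controls $b_0,\dots,b_{H-1}\in\mathsf A$ ($\mathsf A\neq\emptyset$), and let $(S_h^{(n)})_{0\le h\le H}$, $n=1,\dots,N$, be independent copies of the chain $S_0=x_0$, $S_{h+1}\sim P_{h+1}(\cdot\mid S_h,b_h)$. Put $$r_{h,n}(x,a)=\frac{p_{h+1}^a(S_{h+1}^{(n)}\mid x)}{\sum_{k\ne n}p_{h+1}^{b_h}(S_{h+1}^{(n)}\mid S_h^{(k)})},\qquad w_{h,n,N}(x,a)=\frac{r_{h,n}(x,a)}{\sum_{n'=1}^N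 r_{h,n'}(x,a)},$$ and define $\overline V_H=F$ and, for $h=H-1,\dots,0$, $$\overline V_h(x)=\sup_{a\in\mathsf A}\Big(R_h(x,a)+\sum_{n=1}^N\overline V_{h+1}(S_{h+1}^{(n)})\,w_{h,n,N}(x,a)\Big).$$ **Theorem 4.1.** There are absolute constants $C>0$ and $N_0\in\mathbb N$ such that in every such setting, for all $N>N_0$, the random variable $\overline V_0(x_0)-V_0^\star(x_0)$ is integrable and $$\mathbb E\big[|\overline V_0(x_0)-V_0^\star(x_0)|\big]\le C\,\frac{H^2G}{\sqrt N}\left(\frac{L\,\mathrm{DI}(\mathsf S\times\mathsf A)+L\,\mathrm{diam}(\mathsf S)\,\mathrm{diam}(\mathsf A)+\Lambda}{\delta}+\frac{\Lambda^2}{\delta^2}\right).$$ Here $\mathrm{DI}(\mathsf X)=\int_0^{\mathrm{diam}(\mathsf X)}\sqrt{\log\mathcal N(\mathsf X,u)}\,du$ is the Dudley integral, $\mathcal N(\mathsf X,u)$ being the least number of balls of radius $u$ (with centres in the ambient space) that cover $\mathsf X$, and $\mathsf S\times\mathsf A\subset\mathbb R^{d_{\mathsf S}+d_{\mathsf A}}$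 carries the Euclidean metric. -/

import Mathlib

open MeasureTheory ProbabilityTheory

noncomputable section

/-- The product set `X × Y`, inside the Euclidean (ℓ²) product of the ambient spaces. -/
def euclideanProd {E F : Type*} (X : Set E) (Y : Set F) : Set (WithLp 2 (E × F)) :=
  {z | z.fst ∈ X ∧ z.snd ∈ Y}

/-- The Dudley integral `∫₀^{diam X} √(log 𝒩(X, u)) du`, where `𝒩(X, u)` is the smallest number of
balls of radius `u` in the ambient space that cover `X`. For a totally bounded `X` these numbers
are finite for all `u > 0`. -/
def dudleyIntegral {Y : Type*} [PseudoMetricSpace Y] (X : Set Y) : ℝ :=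
  ∫ u in (0 : ℝ)..Metric.diam X,
    √(Real.log (((Metric.externalCoveringNumber u.toNNReal X).toNat : ℕ) : ℝ))

/-- Law of the whole path of the (time-inhomogeneous) Markov chain with initial law `ν` and
transition kernel `κ t` from time `t` to time `t + 1`. -/
def markovPathLaw {X : Type*} [MeasurableSpace X] (ν : Measure X) [IsProbabilityMeasure ν]
    (κ : ℕ → Kernel X X) [∀ t, IsMarkovKernel (κ t)] : Measure (ℕ → X) :=
  Kernel.trajMeasure (X := fun _ => X) ν fun t =>
    (κ t).comap (fun w : (Finset.Iic t → X) => w ⟨t, Finset.mem_Iic.2 le_rfl⟩)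
      (measurable_pi_apply _)

/-- A finite horizon Markov decision process. `P t` is the transition function from time `t - 1` to
time `t`; only the times `1 ≤ t ≤ H` matter. `R t` is the reward at time `t`; only `t < H` matters.
`F` is the terminal reward. -/
structure MDP (S A : Type*) [MeasurableSpace S] [MeasurableSpace A] where
  H : ℕ
  P : ℕ → Kernel (S × A) S
  markov : ∀ t, IsMarkovKernel (P t)
  R : ℕ → S → A → ℝ
  measurable_R : ∀ t, Measurable fun z : S × A => R t z.1 z.2
  F : S → ℝ
  measurable_F : Measurable F

/-- A randomized Markov policy: measurable maps from states to laws on actions, one per time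
(only those at times `t < H` matter). -/
structure Policy (S A : Type*) [MeasurableSpace S] [MeasurableSpace A] where
  ker : ℕ → Kernel S A
  markov : ∀ t, IsMarkovKernel (ker t)

attribute [instance] MDP.markov Policy.markov

namespace MDP

variable {S A : Type*} [MeasurableSpace S] [MeasurableSpace A]

/-- Transition kernel of `(S_t, A_t)` under the policy `π`:
`S_{t+1} ∼ P_{t+1}(· | S_t, A_t)`, then `A_{t+1} ∼ π_{t+1}(S_{t+1})`. -/
def controlledKernel (M : MDP S A) (π : Policy S A) (t : ℕ) : Kernel (S × A) (S × A) :=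
  M.P (t + 1) ⊗ₖ Kernel.prodMkLeft (S × A) (π.ker (t + 1))

instance (M : MDP S A) (π : Policy S A) (t : ℕ) : IsMarkovKernel (M.controlledKernel π t) := by
  unfold controlledKernel; infer_instance

/-- Law of the path `(S_t, A_t)_t` under the policy `π`, with `S_0 = x`, `A_0 ∼ π_0(x)`. -/
def controlledLaw (M : MDP S A) (π : Policy S A) (x : S) : Measure (ℕ → S × A) :=
  markovPathLaw (Measure.dirac x ⊗ₘ π.ker 0) (M.controlledKernel π)

/-- `V_0^π(x)`, the expected total reward of the policy `π` started at `x`. -/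
def policyValue (M : MDP S A) (π : Policy S A) (x : S) : ℝ :=
  ∫ w, ((∑ t ∈ Finset.range M.H, M.R t (w t).1 (w t).2) + M.F (w M.H).1) ∂M.controlledLaw π x

/-- `V_0^⋆(x)`, the maximal expected reward over all policies. -/
def optimalValue (M : MDP S A) (x : S) : ℝ :=
  ⨆ π : Policy S A, M.policyValue π x

/-- Transition kernel `P_{t+1}(· | ·, b_t)` of the state under the deterministic control `b_t`. -/
def openLoopKernel (M : MDP S A) (b : ℕ → A) (t : ℕ) : Kernel S S :=
  (M.P (t + 1)).comap (fun x => (x, b t)) (by fun_prop)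

instance (M : MDP S A) (b : ℕ → A) (t : ℕ) : IsMarkovKernel (M.openLoopKernel b t) := by
  unfold openLoopKernel; infer_instance

/-- Law of the state path started at `x` under the deterministic controls `b`. -/
def openLoopLaw (M : MDP S A) (b : ℕ → A) (x : S) : Measure (ℕ → S) :=
  markovPathLaw (Measure.dirac x) (M.openLoopKernel b)

/-- `X n h` (`n : Fin N`, `h ≤ H`) are `N` independent simulations of the state chain
`(S_h)_{0 ≤ h ≤ H}` started at `x₀` under the deterministic controls `b`. -/
structure IsMeshSample (M : MDP S A) (b : ℕ → A) (x₀ : S) {N : ℕ} {Ω : Type*}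
    [MeasurableSpace Ω] (μ : Measure Ω) (X : Fin N → ℕ → Ω → S) : Prop where
  measurable : ∀ n, ∀ h ≤ M.H, Measurable (X n h)
  indep : iIndepFun (fun n ω (h : Finset.Iic M.H) => X n h ω) μ
  law : ∀ n, μ.map (fun ω (h : Finset.Iic M.H) => X n h ω) =
    (M.openLoopLaw b x₀).map (Preorder.frestrictLe M.H)

/-- The unnormalized mesh weight
`p_{h+1}^a(S_{h+1}^{(n)} | x) / ∑_{k ≠ n} p_{h+1}^{b_h}(S_{h+1}^{(n)} | S_h^{(k)})`.
Here `p t a y x` stands for `p_t^a(y | x)`, and `s n h` for `S_h^{(n)}`. -/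
def meshRatio (p : ℕ → A → S → S → ℝ) (b : ℕ → A) {N : ℕ} (s : Fin N → ℕ → S)
    (h : ℕ) (n : Fin N) (x : S) (a : A) : ℝ :=
  p (h + 1) a (s n (h + 1)) x /
    ∑ k ∈ Finset.univ.erase n, p (h + 1) (b h) (s n (h + 1)) (s k h)

/-- The mesh weight `w_{h,n,N}(x, a)`. -/
def meshWeight (p : ℕ → A → S → S → ℝ) (b : ℕ → A) {N : ℕ} (s : Fin N → ℕ → S)
    (h : ℕ) (n : Fin N) (x : S) (a : A) : ℝ :=
  meshRatio p b s h n x a / ∑ n', meshRatio p b s h n' x a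

/-- The approximate conditional expectation `ℰ_{h,N}(x, a; f)`. -/
def meshExpect (p : ℕ → A → S → S → ℝ) (b : ℕ → A) {N : ℕ} (s : Fin N → ℕ → S)
    (h : ℕ) (f : S → ℝ) (x : S) (a : A) : ℝ :=
  ∑ n, f (s n (h + 1)) * meshWeight p b s h n x a

/-- Backward recursion of the mesh algorithm: `meshValueAux m = V̄_{H-m}`. -/
def meshValueAux (M : MDP S A) (p : ℕ → A → S → S → ℝ) (b : ℕ → A) {N : ℕ}
    (s : Fin N → ℕ → S) : ℕ → S → ℝ
  | 0 => M.F
  | m + 1 => fun x => ⨆ a : A, (M.R (M.H - (m + 1)) x a +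
      meshExpect p b s (M.H - (m + 1)) (meshValueAux M p b s m) x a)

/-- The function `V̄_0` computed by the mesh algorithm from the simulated states `s`. -/
def meshValue (M : MDP S A) (p : ℕ → A → S → S → ℝ) (b : ℕ → A) {N : ℕ}
    (s : Fin N → ℕ → S) : S → ℝ :=
  M.meshValueAux p b s M.H

end MDP

/-- Lebesgue measure on a subset of a Euclidean space, as a measure on the subtype. -/
def lebesgueOn {d : ℕ} (S : Set (EuclideanSpace ℝ (Fin d))) : Measure S :=
  (volume : Measure (EuclideanSpace ℝ (Fin d))).comap Subtype.val

/-- The standing assumptions on an MDP with state set `S` and action set `A` in Euclidean spaces: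
`p t a y x = p_t^a(y | x)` are transition densities with respect to Lebesgue measure, they lie in
`[δ, Λ]` and are Lipschitz in `(x, a)` with a constant `ℓ y`, where the `L¹(S)` and `L^∞(S)` norms
of `ℓ` are at most `L`, and the rewards are bounded by `G`. -/
structure MDP.IsRegular {dS dA : ℕ} {S : Set (EuclideanSpace ℝ (Fin dS))}
    {A : Set (EuclideanSpace ℝ (Fin dA))} (M : MDP S A) (p : ℕ → A → S → S → ℝ)
    (ℓ : S → ℝ) (δ Λ L G : ℝ) : Prop where
  measurable_density : ∀ t, 1 ≤ t → t ≤ M.H → ∀ a x, Measurable fun y => p t a y x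
  density : ∀ t, 1 ≤ t → t ≤ M.H → ∀ a x,
    M.P t (x, a) = (lebesgueOn S).withDensity fun y => ENNReal.ofReal (p t a y x)
  delta_pos : 0 < δ
  Lambda_pos : 0 < Λ
  lower : ∀ t, 1 ≤ t → t ≤ M.H → ∀ a y x, δ ≤ p t a y x
  upper : ∀ t, 1 ≤ t → t ≤ M.H → ∀ a y x, p t a y x ≤ Λ
  lipschitz : ∀ t, 1 ≤ t → t ≤ M.H → ∀ a₁ a₂ y x₁ x₂,
    |p t a₁ y x₁ - p t a₂ y x₂| ≤ ℓ y * (dist x₁ x₂ + dist a₁ a₂)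
  ell_nonneg : ∀ y, 0 ≤ ℓ y
  ell_meas : AEStronglyMeasurable ℓ (lebesgueOn S)
  L_nonneg : 0 ≤ L
  ell_one : eLpNorm ℓ 1 (lebesgueOn S) ≤ ENNReal.ofReal L
  ell_top : eLpNorm ℓ ⊤ (lebesgueOn S) ≤ ENNReal.ofReal L
  reward : ∀ t, t < M.H → ∀ x a, |M.R t x a| ≤ G
  terminal : ∀ x, |M.F x| ≤ G

end

/-!
The mesh algorithm solves the Bellman equation with the conditional expectations replaced by
self-normalized importance sampling sums over the simulated states. Its weights are nonnegative
with sum `1`, so `V̄_0 - V⋆_0` is bounded at every state by the sum over `t` of the uniform errors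
of the approximate conditional expectations of the functions `V⋆_{t+1}`
(`MDP.abs_meshValueAux_sub_dpValueAux_le`). These functions are deterministic and bounded by `H *
G`, so that each of the `H` steps is a problem about independent samples, and the two factors
together give `H ^ 2 * G`.

*One step.* Self-normalization reduces to unnormalized sums, for the given function and for the
constant `1`. In these sums the density of the sample point, which the algorithm estimates by a
leave-one-out mean, is first replaced with the exact one: the leave-one-out mean is conditionally
a mean of independent variables (`integral_abs_leaveOneOut_le`), and this costs `Λ² / (δ² √N)`.
What is left is an empirical process that is Lipschitz in the state-action pair with constant of
order `L / δ`. Its increments are sub-Gaussian by Hoeffding's lemma, and chaining bounds its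
supremum by the Dudley integral (`exists_integrable_dominating_dudley`). The Dudley integral
converges, because covering numbers in finite dimension grow polynomially
(`intervalIntegrable_rootEntropy`), so its Bochner integral has its true value. Suprema over
uncountable sets are never integrated: every bound produces an integrable function that dominates
all members of the family.

*Measurability.* The rewards are only Borel functions of the action, so `V⋆_t` and the computed
value are suprema of Borel functions over an uncountable set, and optimal actions have to be
selected measurably. Both are settled up to null sets by a section theorem for Borel sets in
products of Polish spaces (`MeasurableSet.exists_measurable_section_ae`). Null sets are harmless,
since all laws of states after the first step have Lebesgue densities, and the initial state is
covered by adding a Dirac mass to Lebesgue measure. With `ε`-optimal selectors, Bellman's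
principle (`MDP.optimalValue_eq_dpValue`) identifies `V⋆_0` with the result of dynamic
programming.
-/

noncomputable section

/-! ### Bounded functions -/

section Bounds

theorem integrable_of_abs_le {α : Type*} [MeasurableSpace α] {ρ : Measure α}
    [IsFiniteMeasure ρ] {f : α → ℝ} {c : ℝ} (hm : AEMeasurable f ρ) (hf : ∀ y, |f y| ≤ c) :
    Integrable f ρ :=
  Integrable.of_bound hm.aestronglyMeasurable c (Filter.Eventually.of_forall hf)

theorem abs_integral_le_of_abs_le {α : Type*} [MeasurableSpace α] {ρ : Measure α}
    [IsProbabilityMeasure ρ] {f : α → ℝ} {c : ℝ} (hf : ∀ y, |f y| ≤ c) : |∫ y, f y ∂ρ| ≤ c := by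
  have := norm_integral_le_of_norm_le_const (μ := ρ) (f := f) (Filter.Eventually.of_forall hf)
  simpa using this

theorem abs_ciSup_le {ι : Type*} [Nonempty ι] {f : ι → ℝ} {c : ℝ} (hf : ∀ i, |f i| ≤ c) :
    |⨆ i, f i| ≤ c := by
  have hb : BddAbove (Set.range f) := ⟨c, by rintro _ ⟨i, rfl⟩; exact (abs_le.1 (hf i)).2⟩
  rw [abs_le]
  obtain ⟨i⟩ := ‹Nonempty ι›
  exact ⟨(abs_le.1 (hf i)).1.trans (le_ciSup hb i), ciSup_le fun i => (abs_le.1 (hf i)).2⟩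

theorem abs_iSup_sub_iSup_le {ι : Type*} [Nonempty ι] {f g : ι → ℝ} {c : ℝ}
    (hg : BddAbove (Set.range g)) (h : ∀ i, |f i - g i| ≤ c) : |(⨆ i, f i) - ⨆ i, g i| ≤ c := by
  have hfg (i) : f i ≤ (⨆ i, g i) + c := by
    linarith [(abs_le.1 (h i)).2, le_ciSup hg i]
  have hf : BddAbove (Set.range f) := ⟨_, by rintro _ ⟨i, rfl⟩; exact hfg i⟩
  rw [abs_le]
  constructor
  · have : ⨆ i, g i ≤ (⨆ i, f i) + c := ciSup_le fun i => by
      linarith [(abs_le.1 (h i)).1, le_ciSup hf i]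
    linarith
  · linarith [ciSup_le hfg]

end Bounds

/-! ### Measurable selection up to null sets -/

section MeasurableSelection

variable {X Y : Type*} [TopologicalSpace X] [MeasurableSpace X]

/-- The set of sequences that start with the finite list `u`. -/
def listCylinder (u : List ℕ) : Set (ℕ → ℕ) :=
  {σ | ∀ i (hi : i < u.length), σ i = u[i]}

theorem listCylinder_nil : listCylinder [] = Set.univ := by
  ext σ; simp [listCylinder]

theorem mem_listCylinder_append {u : List ℕ} {σ : ℕ → ℕ} (h : σ ∈ listCylinder u) :
    σ ∈ listCylinder (u ++ [σ u.length]) := by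
  intro i hi
  rcases Nat.lt_or_ge i u.length with h' | h'
  · rw [List.getElem_append_left h']
    exact h i h'
  · have : i = u.length := by
      simp at hi
      omega
    subst this
    simp

/-- **Measurable section of a continuous map, up to a null set.** The measurable hulls of the
images of the cylinders form a scheme in which, off a null set, every point of a hull belongs to
the hull of some child; always taking the least such child defines the section. Keeping the hulls
inside the closures of the images makes the limit a true preimage. -/
theorem exists_measurable_rightInverse_ae [PolishSpace X] [BorelSpace X]
    (ν : Measure X) [SFinite ν] {f : (ℕ → ℕ) → X} (hf : Continuous f) :
    ∃ t : X → (ℕ → ℕ), Measurable t ∧ ∃ E : Set X, MeasurableSet E ∧ Set.range f ⊆ E ∧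
      ∀ᵐ x ∂ν, x ∈ E → f (t x) = x := by
  classical
  let T := listCylinder
  let K : List ℕ → Set X := fun u => toMeasurable ν (f '' T u) ∩ closure (f '' T u)
  have hKm (u) : MeasurableSet (K u) :=
    (measurableSet_toMeasurable _ _).inter isClosed_closure.measurableSet
  have hKc (u) : K u ⊆ closure (f '' T u) := Set.inter_subset_right
  have hsub (u) : f '' T u ⊆ K u := Set.subset_inter (subset_toMeasurable _ _) subset_closure
  have hnull : ∀ᵐ x ∂ν, ∀ u, x ∈ K u → ∃ n, x ∈ K (u ++ [n]) := by
    rw [ae_all_iff]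
    intro u
    have hU : MeasurableSet (⋃ n, K (u ++ [n])) := MeasurableSet.iUnion fun n => hKm _
    have h0 : ν (toMeasurable ν (f '' T u) ∩ (⋃ n, K (u ++ [n]))ᶜ) = 0 := by
      rw [Measure.measure_toMeasurable_inter_of_sFinite hU.compl]
      convert measure_empty (μ := ν)
      rw [← Set.disjoint_iff_inter_eq_empty, Set.disjoint_compl_right_iff_subset]
      rintro _ ⟨σ, hσ, rfl⟩
      exact Set.mem_iUnion.2 ⟨_, hsub _ ⟨σ, mem_listCylinder_append hσ, rfl⟩⟩
    filter_upwards [measure_eq_zero_iff_ae_notMem.1 h0] with x hx hxu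
    by_contra hne
    exact hx ⟨hxu.1, by simpa using hne⟩
  clear_value K
  let P : List ℕ → X → ℕ → Prop := fun u x n => x ∈ K (u ++ [n]) ∨ ∀ m, x ∉ K (u ++ [m])
  have hP (u x) : ∃ n, P u x n := by
    by_cases h : ∃ n, x ∈ K (u ++ [n])
    · exact h.imp fun n hn => Or.inl hn
    · exact ⟨0, Or.inr (by simpa using h)⟩
  let next : List ℕ → X → ℕ := fun u x => Nat.find (hP u x)
  have hspec (u x) : P u x (next u x) := Nat.find_spec (hP u x)
  have hnext (u) : Measurable (next u) := by
    refine measurable_find (hP u) fun n => ?_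
    exact (hKm _).union (by
      have : {x | ∀ m, x ∉ K (u ++ [m])} = ⋂ m, (K (u ++ [m]))ᶜ := by ext; simp
      change MeasurableSet {x | ∀ m, x ∉ K (u ++ [m])}
      exact this ▸ MeasurableSet.iInter fun m => (hKm _).compl)
  clear_value next
  let l : ℕ → X → List ℕ := fun k => Nat.rec (fun _ => []) (fun _ g x => g x ++ [next (g x) x]) k
  have hl0 (x) : l 0 x = [] := rfl
  have hls (k x) : l (k + 1) x = l k x ++ [next (l k x) x] := rfl
  clear_value l
  let _ : MeasurableSpace (List ℕ) := ⊤
  have hlm (k) : Measurable (l k) := by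
    induction k with
    | zero => exact (funext hl0 : l 0 = fun _ => []) ▸ measurable_const
    | succ k ih =>
      have : Measurable (fun z : X × List ℕ => z.2 ++ [next z.2 z.1]) :=
        measurable_from_prod_countable_left fun u =>
          (measurable_from_top (f := fun n => u ++ [n])).comp (hnext u)
      exact (funext (hls k) : l (k + 1) = _) ▸ this.comp (measurable_id.prodMk ih)
  let t : X → (ℕ → ℕ) := fun x k => next (l k x) x
  have hlen (k x) : (l k x).length = k := by
    induction k with
    | zero => rw [hl0]; rfl
    | succ k ih => rw [hls, List.length_append, ih]; rfl
  have htl (k x) : t x ∈ T (l k x) := by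
    induction k with
    | zero => intro i hi; simp [hl0] at hi
    | succ k ih =>
      have := mem_listCylinder_append ih
      rw [hlen] at this
      rwa [hls]
  refine ⟨t, measurable_pi_iff.2 fun k => ?_, K [], hKm _, ?_, ?_⟩
  · have : Measurable (fun z : X × List ℕ => next z.2 z.1) :=
      measurable_from_prod_countable_left fun u => hnext u
    exact this.comp (measurable_id.prodMk (hlm k))
  · have := hsub []
    rwa [show T [] = Set.univ from listCylinder_nil, Set.image_univ] at this
  · filter_upwards [hnull] with x hx hxE
    have hmem (k) : x ∈ K (l k x) := by
      induction k with
      | zero => rwa [hl0]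
      | succ k ih =>
        obtain ⟨n, hn⟩ := hx _ ih
        rw [hls]
        rcases hspec (l k x) x with h | h
        · exact h
        · exact absurd hn (h n)
    let _ := TopologicalSpace.upgradeIsCompletelyMetrizable X
    have hτ (k : ℕ) : ∃ τ ∈ T (l k x), dist x (f τ) < 1 / ((k : ℝ) + 1) := by
      obtain ⟨_, ⟨τ, hτ, rfl⟩, hd⟩ := Metric.mem_closure_iff.1 (hKc _ (hmem k)) _
        (Nat.one_div_pos_of_nat (α := ℝ) (n := k))
      exact ⟨τ, hτ, hd⟩
    choose τ hτT hτd using hτ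
    have h1 : Filter.Tendsto τ Filter.atTop (nhds (t x)) := by
      rw [tendsto_pi_nhds]
      intro i
      refine tendsto_const_nhds.congr' ?_
      filter_upwards [Filter.eventually_gt_atTop i] with k hk
      rw [hτT k i (by rw [hlen]; exact hk), htl k x i (by rw [hlen]; exact hk)]
    have h2 : Filter.Tendsto (fun k => f (τ k)) Filter.atTop (nhds x) := by
      rw [tendsto_iff_dist_tendsto_zero]
      refine squeeze_zero (fun _ => dist_nonneg) (fun k => ?_)
        (tendsto_one_div_add_atTop_nhds_zero_nat (𝕜 := ℝ))
      rw [dist_comm]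
      exact (hτd k).le
    exact tendsto_nhds_unique ((hf.tendsto _).comp h1) h2

variable [PolishSpace X] [BorelSpace X]
  [TopologicalSpace Y] [PolishSpace Y] [MeasurableSpace Y] [BorelSpace Y]

/-- A Borel set in a product has a Borel uniformization, off a null set of the first factor. -/
theorem MeasurableSet.exists_measurable_section_ae [Nonempty Y] (ν : Measure X) [SFinite ν]
    {B : Set (X × Y)} (hB : MeasurableSet B) :
    ∃ s : X → Y, Measurable s ∧ ∃ E : Set X, MeasurableSet E ∧ Prod.fst '' B ⊆ E ∧
      ∀ᵐ x ∂ν, x ∈ E → (x, s x) ∈ B := by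
  have hA := hB.analyticSet
  rw [AnalyticSet] at hA
  rcases hA with rfl | ⟨φ, hφ, rfl⟩
  · exact ⟨fun _ => Classical.arbitrary Y, measurable_const, ∅, MeasurableSet.empty, by simp,
      by simp⟩
  · obtain ⟨t, ht, E, hE, hsub, hae⟩ := exists_measurable_rightInverse_ae ν (continuous_fst.comp hφ)
    refine ⟨fun x => (φ (t x)).2, (continuous_snd.comp hφ).measurable.comp ht, E, hE, ?_, ?_⟩
    · rw [← Set.range_comp]; exact hsub
    · filter_upwards [hae] with x hx hxE
      refine ⟨t x, Prod.ext (hx hxE) rfl⟩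

theorem MeasurableSet.nullMeasurableSet_image_fst [Nonempty Y] (ν : Measure X) [SFinite ν]
    {B : Set (X × Y)} (hB : MeasurableSet B) : NullMeasurableSet (Prod.fst '' B) ν := by
  obtain ⟨s, -, E, hE, hsub, hae⟩ := hB.exists_measurable_section_ae ν
  refine hE.nullMeasurableSet.congr ?_
  filter_upwards [hae] with x hx
  refine propext ⟨fun h => ⟨_, hx h, rfl⟩, fun h => hsub h⟩

/-- The supremum of a Borel function over the second variable is measurable up to a null set. -/
theorem aemeasurable_iSup_of_measurable_prod [Nonempty Y] (ν : Measure X) [SFinite ν]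
    {f : X × Y → ℝ} (hf : Measurable f) (hb : ∀ x, BddAbove (Set.range fun y => f (x, y))) :
    AEMeasurable (fun x => ⨆ y, f (x, y)) ν := by
  have : NullMeasurable (fun x => ⨆ y, f (x, y)) ν := by
    refine @measurable_of_Ioi ℝ (NullMeasurableSpace X ν) _ _ _ _ _ _ _ _ fun c => ?_
    have : (fun x => ⨆ y, f (x, y)) ⁻¹' Set.Ioi c = Prod.fst '' (f ⁻¹' Set.Ioi c) := by
      ext x
      simp only [Set.mem_preimage, Set.mem_Ioi, Set.mem_image, Prod.exists, exists_and_right,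
        exists_eq_right]
      exact lt_ciSup_iff (hb x)
    exact this ▸ (hf measurableSet_Ioi).nullMeasurableSet_image_fst ν
  exact this.aemeasurable

/-- An `ε`-optimal choice of the second coordinate can be made Borel measurably off a null set. -/
theorem exists_measurable_forall_iSup_sub_le [Nonempty Y] (ν : Measure X) [SFinite ν]
    {f : X × Y → ℝ} (hf : Measurable f) (hb : ∀ x, BddAbove (Set.range fun y => f (x, y)))
    {ε : ℝ} (hε : 0 < ε) :
    ∃ s : X → Y, Measurable s ∧ ∀ᵐ x ∂ν, (⨆ y, f (x, y)) - ε ≤ f (x, s x) := by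
  have hm := aemeasurable_iSup_of_measurable_prod ν hf hb
  have hB : MeasurableSet {z : X × Y | hm.mk _ z.1 - ε < f z} :=
    measurableSet_lt ((hm.measurable_mk.comp measurable_fst).sub_const ε) hf
  obtain ⟨s, hs, E, -, hsub, hae⟩ := hB.exists_measurable_section_ae ν
  refine ⟨s, hs, ?_⟩
  filter_upwards [hae, hm.ae_eq_mk] with x hx hxm
  obtain ⟨y, hy⟩ := exists_lt_of_lt_ciSup (show (⨆ y, f (x, y)) - ε < ⨆ y, f (x, y) by linarith)
  have := hx (hsub ⟨(x, y), by simpa only [Set.mem_ofPred_eq, ← hxm] using hy, rfl⟩)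
  simp only [← hxm] at this
  exact this.le

end MeasurableSelection

/-! ### Markov chains and Bellman's principle -/

section MeasureComp

variable {α β : Type*} [MeasurableSpace α] [MeasurableSpace β] {κ : Kernel α β} {ρ : Measure α}
  {f : β → ℝ}

theorem MeasureTheory.Integrable.integral_measureComp [IsSFiniteKernel κ] [SFinite ρ]
    (hf : Integrable f (κ ∘ₘ ρ)) :
    Integrable (fun x => ∫ y, f y ∂κ x) ρ := by
  have h : κ ∘ₘ ρ = (κ ∘ₖ Kernel.const Unit ρ) () := by rw [Kernel.comp_apply, Kernel.const_apply]
  rw [h] at hf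
  simpa using hf.integral_comp

theorem integral_measureComp [IsSFiniteKernel κ] [SFinite ρ] (hf : Integrable f (κ ∘ₘ ρ)) :
    ∫ y, f y ∂(κ ∘ₘ ρ) = ∫ x, ∫ y, f y ∂κ x ∂ρ := by
  have h : κ ∘ₘ ρ = (κ ∘ₖ Kernel.const Unit ρ) () := by rw [Kernel.comp_apply, Kernel.const_apply]
  rw [h] at hf ⊢
  simpa using Kernel.integral_comp hf

end MeasureComp

section MarkovPath

variable {X : Type*} [MeasurableSpace X] (ν : Measure X) [IsProbabilityMeasure ν]
  (κ : ℕ → Kernel X X) [∀ t, IsMarkovKernel (κ t)]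

instance : IsProbabilityMeasure (markovPathLaw ν κ) := by
  unfold markovPathLaw; infer_instance

theorem markovPathLaw_map_zero : (markovPathLaw ν κ).map (fun w => w 0) = ν := by
  have h1 : (fun w : ℕ → X => w 0) =
      (fun v : Finset.Iic 0 → X => v ⟨0, by simp⟩) ∘ Preorder.frestrictLe 0 := rfl
  rw [h1, ← Measure.map_map (by fun_prop) (by fun_prop), markovPathLaw, Kernel.trajMeasure,
    Measure.map_comp _ _ (by fun_prop), Kernel.traj_map_frestrictLe, Kernel.partialTraj_self,
    Measure.id_comp, Measure.map_map (by fun_prop) (by fun_prop)]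
  convert! Measure.map_id (μ := ν)

theorem markovPathLaw_map_pair (t : ℕ) :
    (markovPathLaw ν κ).map (fun w => (w t, w (t + 1))) =
      ((markovPathLaw ν κ).map (fun w => w t)) ⊗ₘ κ t := by
  have h := Kernel.map_frestrictLe_trajMeasure_compProd_eq_map_trajMeasure (X := fun _ => X)
    (μ₀ := ν) (a := t) (κ := fun t => (κ t).comap (fun w : (Finset.Iic t → X) =>
      w ⟨t, Finset.mem_Iic.2 le_rfl⟩) (measurable_pi_apply _))
  have h' := congrArg (Measure.map (Prod.map (fun w : (Finset.Iic t → X) =>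
      w ⟨t, Finset.mem_Iic.2 le_rfl⟩) id)) h
  rw [Measure.map_map (by fun_prop) (by fun_prop)] at h'
  refine h'.symm.trans ?_
  ext s hs
  have hs' : MeasurableSet (Prod.map (fun w : (Finset.Iic t → X) =>
      w ⟨t, Finset.mem_Iic.2 le_rfl⟩) id ⁻¹' s) := hs.preimage (by fun_prop)
  rw [Measure.map_apply (by fun_prop) hs, Measure.compProd_apply hs', Measure.compProd_apply hs,
    lintegral_map (Kernel.measurable_kernel_prodMk_left hs') (by fun_prop),
    lintegral_map (Kernel.measurable_kernel_prodMk_left hs) (by fun_prop)]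
  rfl

theorem markovPathLaw_map_succ (t : ℕ) :
    (markovPathLaw ν κ).map (fun w => w (t + 1)) =
      κ t ∘ₘ (markovPathLaw ν κ).map (fun w => w t) := by
  rw [← Measure.snd_compProd, ← markovPathLaw_map_pair, Measure.snd,
    Measure.map_map (by fun_prop) (by fun_prop)]
  rfl

end MarkovPath

namespace MDP

section ControlledLaw

variable {S A : Type*} [MeasurableSpace S] [MeasurableSpace A] (M : MDP S A) (π : Policy S A)
  (x : S)

instance : IsProbabilityMeasure (M.controlledLaw π x) := by
  unfold controlledLaw; infer_instance

/-- Law of the state-action pair at time `t`. -/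
def pairLaw (t : ℕ) : Measure (S × A) := (M.controlledLaw π x).map fun w => w t

/-- Law of the state at time `t`. -/
def stateLaw (t : ℕ) : Measure S := (M.pairLaw π x t).map Prod.fst

instance (t : ℕ) : IsProbabilityMeasure (M.pairLaw π x t) :=
  Measure.isProbabilityMeasure_map (measurable_pi_apply t).aemeasurable

instance (t : ℕ) : IsProbabilityMeasure (M.stateLaw π x t) :=
  Measure.isProbabilityMeasure_map (by fun_prop)

theorem pairLaw_zero : M.pairLaw π x 0 = Measure.dirac x ⊗ₘ π.ker 0 :=
  markovPathLaw_map_zero _ _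

theorem pairLaw_succ (t : ℕ) :
    M.pairLaw π x (t + 1) = (M.P (t + 1) ∘ₘ M.pairLaw π x t) ⊗ₘ π.ker (t + 1) := by
  have : M.pairLaw π x (t + 1) = M.controlledKernel π t ∘ₘ M.pairLaw π x t :=
    markovPathLaw_map_succ _ _ t
  rw [this]
  ext s hs
  rw [Measure.bind_apply hs (by fun_prop), Measure.compProd_apply hs,
    Measure.lintegral_bind (by fun_prop) (Kernel.measurable_kernel_prodMk_left hs).aemeasurable]
  refine lintegral_congr fun z => ?_
  rw [controlledKernel, Kernel.compProd_apply hs]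
  rfl

theorem stateLaw_zero : M.stateLaw π x 0 = Measure.dirac x := by
  rw [stateLaw, pairLaw_zero]; exact Measure.fst_compProd _ _

theorem stateLaw_succ (t : ℕ) :
    M.stateLaw π x (t + 1) = M.P (t + 1) ∘ₘ M.pairLaw π x t := by
  rw [stateLaw, pairLaw_succ]; exact Measure.fst_compProd _ _

theorem pairLaw_eq (t : ℕ) : M.pairLaw π x t = M.stateLaw π x t ⊗ₘ π.ker t := by
  cases t with
  | zero => rw [stateLaw_zero, pairLaw_zero]
  | succ t => rw [stateLaw_succ, pairLaw_succ]

end ControlledLaw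

section BoundedRewards

variable {S A : Type*} [MeasurableSpace S] [MeasurableSpace A] {M : MDP S A}

/-- The value functions of dynamic programming, indexed by the number of remaining steps:
`dpValueAux m = V⋆_{H-m}`. -/
def dpValueAux (M : MDP S A) : ℕ → S → ℝ
  | 0 => M.F
  | m + 1 => fun x => ⨆ a : A, (M.R (M.H - (m + 1)) x a +
      ∫ y, dpValueAux M m y ∂M.P (M.H - (m + 1) + 1) (x, a))

/-- The value function `V⋆_t` of dynamic programming, at time `t`. -/
def dpValue (M : MDP S A) (t : ℕ) : S → ℝ := M.dpValueAux (M.H - t)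

/-- The state-action value function at time `t`. -/
def dpActionValue (M : MDP S A) (t : ℕ) (z : S × A) : ℝ :=
  M.R t z.1 z.2 + ∫ y, M.dpValue (t + 1) y ∂M.P (t + 1) z

theorem dpValue_horizon : M.dpValue M.H = M.F := by simp [dpValue, dpValueAux]

theorem dpValue_of_lt {t : ℕ} (ht : t < M.H) (x : S) :
    M.dpValue t x = ⨆ a, M.dpActionValue t (x, a) := by
  obtain ⟨m, hm⟩ : ∃ m, M.H - t = m + 1 := ⟨M.H - t - 1, by omega⟩
  have h1 : M.H - (m + 1) = t := by omega
  have h2 : M.H - (t + 1) = m := by omega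
  simp only [dpActionValue, dpValue, hm, h2, dpValueAux, h1]

variable {G : ℝ} {x : S} {ν : Measure S}

theorem measurable_dpActionValue (hP : ∀ t, 1 ≤ t → t ≤ M.H → ∀ z, M.P t z ≪ ν) {t : ℕ}
    (ht : t < M.H) (hV : AEMeasurable (M.dpValue (t + 1)) ν) : Measurable (M.dpActionValue t) := by
  have : M.dpActionValue t = fun z => M.R t z.1 z.2 + ∫ y, hV.mk _ y ∂M.P (t + 1) z := by
    funext z
    rw [dpActionValue, integral_congr_ae ((hP _ (by omega) ht z).ae_eq hV.ae_eq_mk)]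
  rw [this]
  exact (M.measurable_R t).add (hV.measurable_mk.stronglyMeasurable.integral_kernel).measurable

theorem stateLaw_absolutelyContinuous (hP : ∀ t, 1 ≤ t → t ≤ M.H → ∀ z, M.P t z ≪ ν)
    (hx : Measure.dirac x ≪ ν) (π : Policy S A) {t : ℕ} (ht : t ≤ M.H) : M.stateLaw π x t ≪ ν := by
  cases t with
  | zero => rwa [stateLaw_zero]
  | succ t =>
    rw [stateLaw_succ]
    refine Measure.AbsolutelyContinuous.mk fun s hs h0 => ?_
    rw [Measure.bind_apply hs (by fun_prop)]
    exact (lintegral_congr fun z => hP _ (by omega) ht z h0).trans (by simp)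

theorem policyValue_eq (hR : ∀ t, t < M.H → ∀ x a, |M.R t x a| ≤ G) (hF : ∀ x, |M.F x| ≤ G)
    (π : Policy S A) : M.policyValue π x =
      (∑ t ∈ Finset.range M.H, ∫ z, M.R t z.1 z.2 ∂M.pairLaw π x t) +
        ∫ y, M.F y ∂M.stateLaw π x M.H := by
  have h1 (t : ℕ) : Measurable fun w : ℕ → S × A => w t := measurable_pi_apply t
  have hRi (t : ℕ) (ht : t ∈ Finset.range M.H) :
      Integrable (fun w : ℕ → S × A => M.R t (w t).1 (w t).2) (M.controlledLaw π x) :=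
    integrable_of_abs_le ((M.measurable_R t).comp (h1 t)).aemeasurable
      fun w => hR t (Finset.mem_range.1 ht) _ _
  rw [policyValue, integral_add (integrable_finsetSum _ hRi), integral_finsetSum _ hRi]
  · congr 1
    · refine Finset.sum_congr rfl fun t _ => ?_
      rw [pairLaw, integral_map (h1 t).aemeasurable (M.measurable_R t).aestronglyMeasurable]
    · rw [stateLaw, pairLaw, Measure.map_map (by fun_prop) (h1 _),
        integral_map (measurable_fst.comp (h1 _)).aemeasurable
          M.measurable_F.aestronglyMeasurable]
      rfl
  · exact integrable_of_abs_le (M.measurable_F.comp (measurable_fst.comp (h1 _))).aemeasurable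
      fun w => hF _

variable [Nonempty A]


theorem abs_dpValueAux_le (hR : ∀ t, t < M.H → ∀ x a, |M.R t x a| ≤ G) (hF : ∀ x, |M.F x| ≤ G)
    {m : ℕ} (hm : m ≤ M.H) (x : S) : |M.dpValueAux m x| ≤ (m + 1) * G := by
  induction m generalizing x with
  | zero => simpa [dpValueAux] using hF x
  | succ m ih =>
    refine abs_ciSup_le fun a => (abs_add_le _ _).trans ((add_le_add (hR _ (by omega) _ _)
        (abs_integral_le_of_abs_le (ih (by omega)))).trans (le_of_eq ?_))
    push_cast
    ring

theorem abs_dpValue_le (hR : ∀ t, t < M.H → ∀ x a, |M.R t x a| ≤ G) (hF : ∀ x, |M.F x| ≤ G)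
    (hG : 0 ≤ G) (t : ℕ) (x : S) : |M.dpValue t x| ≤ (M.H + 1) * G := by
  refine (abs_dpValueAux_le hR hF (Nat.sub_le _ _) x).trans ?_
  have : ((M.H - t : ℕ) : ℝ) ≤ M.H := by exact_mod_cast Nat.sub_le _ _
  gcongr

theorem abs_dpActionValue_le (hR : ∀ t, t < M.H → ∀ x a, |M.R t x a| ≤ G)
    (hF : ∀ x, |M.F x| ≤ G) (hG : 0 ≤ G) {t : ℕ} (ht : t < M.H) (z : S × A) :
    |M.dpActionValue t z| ≤ G + (M.H + 1) * G :=
  (abs_add_le _ _).trans (add_le_add (hR _ ht _ _)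
    (abs_integral_le_of_abs_le (abs_dpValue_le hR hF hG _)))

section Measurability

variable [TopologicalSpace S] [PolishSpace S] [BorelSpace S]
  [TopologicalSpace A] [PolishSpace A] [BorelSpace A] [SFinite ν]

theorem aemeasurable_dpValue (hP : ∀ t, 1 ≤ t → t ≤ M.H → ∀ z, M.P t z ≪ ν)
    (hR : ∀ t, t < M.H → ∀ x a, |M.R t x a| ≤ G) (hF : ∀ x, |M.F x| ≤ G) (hG : 0 ≤ G)
    {t : ℕ} (ht : t ≤ M.H) : AEMeasurable (M.dpValue t) ν := by
  induction ht using Nat.decreasingInduction with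
  | self => exact dpValue_horizon (M := M) ▸ M.measurable_F.aemeasurable
  | of_succ t ht ih =>
    rw [funext (dpValue_of_lt ht)]
    refine aemeasurable_iSup_of_measurable_prod ν (measurable_dpActionValue hP ht ih) fun x => ?_
    exact ⟨_, by rintro _ ⟨a, rfl⟩; exact (abs_le.1 (abs_dpActionValue_le hR hF hG ht _)).2⟩

/-- One step of the reward, plus the value afterwards, in terms of the state-action value. -/
theorem integral_reward_add_dpValue (hP : ∀ t, 1 ≤ t → t ≤ M.H → ∀ z, M.P t z ≪ ν)
    (hx : Measure.dirac x ≪ ν)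
    (hR : ∀ t, t < M.H → ∀ x a, |M.R t x a| ≤ G) (hF : ∀ x, |M.F x| ≤ G) (hG : 0 ≤ G)
    (π : Policy S A) {t : ℕ} (ht : t < M.H) :
    (∫ z, M.R t z.1 z.2 ∂M.pairLaw π x t) + ∫ y, M.dpValue (t + 1) y ∂M.stateLaw π x (t + 1) =
      ∫ z, M.dpActionValue t z ∂M.pairLaw π x t := by
  have hV := aemeasurable_dpValue hP hR hF hG (Nat.succ_le_of_lt ht)
  have hVi : Integrable (M.dpValue (t + 1)) (M.stateLaw π x (t + 1)) :=
    integrable_of_abs_le (hV.mono_ac (stateLaw_absolutelyContinuous hP hx π ht))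
      (abs_dpValue_le hR hF hG _)
  rw [stateLaw_succ] at hVi ⊢
  have hVi' := hVi.integral_measureComp
  rw [integral_measureComp hVi, ← integral_add]
  · rfl
  · exact integrable_of_abs_le (M.measurable_R t).aemeasurable fun z => hR t ht _ _
  · exact hVi'

/-- The policy value falls short of `V⋆_0` by the accumulated losses of the single steps. -/
theorem dpValue_sub_policyValue (hP : ∀ t, 1 ≤ t → t ≤ M.H → ∀ z, M.P t z ≪ ν)
    (hx : Measure.dirac x ≪ ν)
    (hR : ∀ t, t < M.H → ∀ x a, |M.R t x a| ≤ G) (hF : ∀ x, |M.F x| ≤ G) (hG : 0 ≤ G)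
    (π : Policy S A) : M.dpValue 0 x - M.policyValue π x =
      ∑ t ∈ Finset.range M.H, ((∫ y, M.dpValue t y ∂M.stateLaw π x t) -
        ∫ z, M.dpActionValue t z ∂M.pairLaw π x t) := by
  have h0 : ∫ y, M.dpValue 0 y ∂M.stateLaw π x 0 = M.dpValue 0 x := by
    rw [stateLaw_zero, integral_dirac]
  have h1 := Finset.sum_range_sub' (fun t => ∫ y, M.dpValue t y ∂M.stateLaw π x t) M.H
  rw [h0, dpValue_horizon] at h1
  rw [policyValue_eq hR hF, ← sub_sub, sub_right_comm, ← h1, ← Finset.sum_sub_distrib]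
  refine Finset.sum_congr rfl fun t ht => ?_
  rw [← integral_reward_add_dpValue hP hx hR hF hG π (Finset.mem_range.1 ht)]
  ring

/-- A deterministic policy. -/
def deterministicPolicy (α : ℕ → S → A) (hα : ∀ t, Measurable (α t)) : Policy S A where
  ker t := Kernel.deterministic (α t) (hα t)
  markov _ := inferInstance

/-- **Bellman's principle**: the supremum over all policies is given by dynamic programming. -/
theorem optimalValue_eq_dpValue (hP : ∀ t, 1 ≤ t → t ≤ M.H → ∀ z, M.P t z ≪ ν)
    (hx : Measure.dirac x ≪ ν)
    (hR : ∀ t, t < M.H → ∀ x a, |M.R t x a| ≤ G) (hF : ∀ x, |M.F x| ≤ G) (hG : 0 ≤ G) :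
    M.optimalValue x = M.dpValue 0 x := by
  have hbdd (t : ℕ) (ht : t < M.H) (x : S) :
      BddAbove (Set.range fun a => M.dpActionValue t (x, a)) :=
    ⟨_, by rintro _ ⟨a, rfl⟩; exact (abs_le.1 (abs_dpActionValue_le hR hF hG ht _)).2⟩
  have hV (t : ℕ) (ht : t ≤ M.H) := aemeasurable_dpValue hP hR hF hG ht
  have hVi (π : Policy S A) {t : ℕ} (ht : t ≤ M.H) :
      Integrable (M.dpValue t) (M.stateLaw π x t) :=
    integrable_of_abs_le ((hV t ht).mono_ac (stateLaw_absolutelyContinuous hP hx π ht))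
      (abs_dpValue_le hR hF hG _)
  have hQ (t : ℕ) (ht : t < M.H) := measurable_dpActionValue hP ht (hV _ ht)
  have hle (π : Policy S A) : M.policyValue π x ≤ M.dpValue 0 x := by
    rw [← sub_nonneg, dpValue_sub_policyValue hP hx hR hF hG]
    refine Finset.sum_nonneg fun t ht => ?_
    rw [Finset.mem_range] at ht
    have hi := hVi π ht.le
    rw [stateLaw] at hi ⊢
    rw [sub_nonneg, integral_map measurable_fst.aemeasurable hi.aestronglyMeasurable]
    refine integral_mono (integrable_of_abs_le (hQ t ht).aemeasurable
      (abs_dpActionValue_le hR hF hG ht)) (hi.comp_measurable measurable_fst) fun z => ?_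
    dsimp only
    rw [dpValue_of_lt ht]
    exact le_ciSup (hbdd t ht z.1) z.2
  obtain ⟨a₀⟩ := ‹Nonempty A›
  have : Nonempty A := ⟨a₀⟩
  have : Nonempty (Policy S A) := ⟨deterministicPolicy (fun _ _ => a₀) fun _ => measurable_const⟩
  refine le_antisymm (ciSup_le hle) (le_of_forall_pos_le_add fun ε hε => ?_)
  set η : ℝ := ε / (M.H + 1) with hη
  have hη0 : 0 < η := by positivity
  have hsel (t : ℕ) : ∃ α : S → A, Measurable α ∧ (t < M.H → ∀ᵐ y ∂ν,
      M.dpValue t y - η ≤ M.dpActionValue t (y, α y)) := by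
    by_cases ht : t < M.H
    · obtain ⟨α, hα, h⟩ := exists_measurable_forall_iSup_sub_le ν (hQ t ht) (hbdd t ht) hη0
      exact ⟨α, hα, fun _ => h.mono fun y hy => (dpValue_of_lt ht y).symm ▸ hy⟩
    · exact ⟨fun _ => a₀, measurable_const, fun h => absurd h ht⟩
  choose α hα hαae using hsel
  let π := deterministicPolicy α hα
  have hπ : M.dpValue 0 x - M.policyValue π x ≤ ε := by
    rw [dpValue_sub_policyValue hP hx hR hF hG]
    calc _ ≤ ∑ t ∈ Finset.range M.H, η := Finset.sum_le_sum fun t ht => ?_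
      _ ≤ ε := by
        rw [Finset.sum_const, Finset.card_range, nsmul_eq_mul, hη, ← mul_div_assoc,
          div_le_iff₀ (by positivity)]
        nlinarith
    rw [Finset.mem_range] at ht
    have hp : M.pairLaw π x t = (M.stateLaw π x t).map (fun y => (y, α t y)) := by
      rw [pairLaw_eq]
      exact Measure.compProd_deterministic (hα t)
    have hmm : Measurable fun y => (y, α t y) := measurable_id.prodMk (hα t)
    have hi2 : Integrable (fun y => M.dpActionValue t (y, α t y)) (M.stateLaw π x t) :=
      integrable_of_abs_le ((hQ t ht).comp hmm).aemeasurable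
        fun y => abs_dpActionValue_le hR hF hG ht _
    rw [hp, integral_map hmm.aemeasurable (hQ t ht).aestronglyMeasurable,
      ← integral_sub (hVi π ht.le) hi2]
    calc _ ≤ ∫ _, η ∂M.stateLaw π x t := integral_mono_ae ((hVi π ht.le).sub hi2)
            (integrable_const _) ?_
      _ = η := by simp
    filter_upwards [(stateLaw_absolutelyContinuous hP hx π ht.le).ae_le (hαae t ht)] with y hy
    rw [Pi.sub_apply]
    linarith
  have : M.policyValue π x ≤ M.optimalValue x :=
    le_ciSup (f := fun π => M.policyValue π x) ⟨_, by rintro _ ⟨π, rfl⟩; exact hle π⟩ π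
  linarith

end Measurability
end BoundedRewards
end MDP

/-! ### Maxima of sub-Gaussian variables -/

section SubGaussianMaximum

open scoped NNReal

/-- Finitely many sub-Gaussian variables are dominated by an integrable function with the expected
size. The function is explicit, a sum of exponentials coming from `x ≤ exp x - 1`. -/
theorem exists_integrable_dominating_of_hasSubgaussianMGF {Ω ι : Type*} [MeasurableSpace Ω]
    {μ : Measure Ω} [IsProbabilityMeasure μ] (I : Finset ι) {Y : ι → Ω → ℝ} {s m : ℝ} (hs : 0 < s)
    (hY : ∀ i ∈ I, ∃ c : ℝ≥0, (c : ℝ) ≤ s ^ 2 ∧ HasSubgaussianMGF (Y i) c μ)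
    (hm : 1 ≤ m) (hI : (I.card : ℝ) ≤ m) :
    ∃ Φ : Ω → ℝ, Integrable Φ μ ∧ (∀ ω, ∀ i ∈ I, |Y i ω| ≤ Φ ω) ∧
      ∫ ω, Φ ω ∂μ ≤ s * √(2 * Real.log (2 * m)) := by
  have hlog : 0 < Real.log (2 * m) := Real.log_pos (by linarith)
  set u : ℝ := √(2 * Real.log (2 * m)) with hu
  have hu0 : 0 < u := Real.sqrt_pos.2 (by linarith)
  have hu2 : u ^ 2 = 2 * Real.log (2 * m) := Real.sq_sqrt (by linarith)
  set t : ℝ := u / s with ht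
  have ht0 : 0 < t := by positivity
  have hst : s * t = u := by rw [ht]; field_simp
  set K : ℝ := 2 * m * Real.exp (s ^ 2 * t ^ 2 / 2) with hK
  have hK0 : 0 < K := by positivity
  have hlogK : Real.log K = u ^ 2 := by
    rw [hK, Real.log_mul (by positivity) (by positivity), Real.log_exp, ← mul_pow, hst, hu2]
    ring
  have hexp (i) (hi : i ∈ I) (r : ℝ) : Integrable (fun ω => Real.exp (r * Y i ω)) μ := by
    obtain ⟨c, -, h⟩ := hY i hi
    exact h.integrable_exp_mul r
  have hmgf (i) (hi : i ∈ I) (r : ℝ) (hr : r ^ 2 = t ^ 2) :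
      ∫ ω, Real.exp (r * Y i ω) ∂μ ≤ Real.exp (s ^ 2 * t ^ 2 / 2) := by
    obtain ⟨c, hc, h⟩ := hY i hi
    refine (h.mgf_le r).trans (Real.exp_le_exp.2 ?_)
    rw [hr]
    gcongr
  have hint : Integrable (fun ω => ∑ i ∈ I,
      (Real.exp (t * Y i ω) + Real.exp (-t * Y i ω))) μ :=
    integrable_finsetSum _ fun i hi => (hexp i hi t).add (hexp i hi (-t))
  refine ⟨fun ω => (Real.log K - 1 +
    (∑ i ∈ I, (Real.exp (t * Y i ω) + Real.exp (-t * Y i ω))) / K) / t, ?_, ?_, ?_⟩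
  · exact ((integrable_const _).add (hint.div_const _)).div_const _
  · intro ω i hi
    rw [le_div_iff₀ ht0]
    have h1 := Real.add_one_le_exp (|Y i ω| * t - Real.log K)
    rw [Real.exp_sub, Real.exp_log hK0] at h1
    have h2 : Real.exp (|Y i ω| * t) ≤ Real.exp (t * Y i ω) + Real.exp (-t * Y i ω) := by
      rcases abs_cases (Y i ω) with ⟨h, -⟩ | ⟨h, -⟩
      · rw [h, mul_comm]; linarith [Real.exp_pos (-t * Y i ω)]
      · rw [h, show -Y i ω * t = -t * Y i ω by ring]; linarith [Real.exp_pos (t * Y i ω)]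
    have h3 : Real.exp (t * Y i ω) + Real.exp (-t * Y i ω) ≤
        ∑ i ∈ I, (Real.exp (t * Y i ω) + Real.exp (-t * Y i ω)) :=
      Finset.single_le_sum (f := fun i => Real.exp (t * Y i ω) + Real.exp (-t * Y i ω))
        (fun i _ => by positivity) hi
    have h4 := div_le_div_of_nonneg_right (h2.trans h3) hK0.le
    linarith
  · rw [integral_div, integral_add (integrable_const _) (hint.div_const _), integral_div,
      integral_const]
    have h5 : ∫ ω, ∑ i ∈ I, (Real.exp (t * Y i ω) + Real.exp (-t * Y i ω)) ∂μ ≤ K := by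
      calc _ = ∑ i ∈ I, ∫ ω, (Real.exp (t * Y i ω) + Real.exp (-t * Y i ω)) ∂μ :=
            integral_finsetSum _ fun i hi => (hexp i hi t).add (hexp i hi (-t))
        _ ≤ ∑ i ∈ I, 2 * Real.exp (s ^ 2 * t ^ 2 / 2) := Finset.sum_le_sum fun i hi => by
            rw [integral_add (hexp i hi t) (hexp i hi (-t)), two_mul]
            exact add_le_add (hmgf i hi t rfl) (hmgf i hi (-t) (by ring))
        _ ≤ K := by
            rw [Finset.sum_const, nsmul_eq_mul, hK]
            nlinarith [Real.exp_pos (s ^ 2 * t ^ 2 / 2)]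
    have h6 := (div_le_one hK0).2 h5
    rw [div_le_iff₀ ht0, hlogK, show s * u * t = u ^ 2 by rw [← hst]; ring]
    simp only [probReal_univ, one_smul]
    linarith

end SubGaussianMaximum

/-! ### Metric entropy -/

section MetricEntropy

open Metric (externalCoveringNumber)

variable {E : Type*}

/-- In finite dimension the covering number of a bounded set at radius `R / 2 ^ k` grows at most
exponentially in `k`. -/
theorem exists_externalCoveringNumber_le_pow [NormedAddCommGroup E] [NormedSpace ℝ E]
    [FiniteDimensional ℝ E] {T : Set E} (hT : Bornology.IsBounded T) :
    ∃ (R : ℝ) (K : ℕ), 0 < R ∧ 1 ≤ K ∧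
      ∀ k : ℕ, externalCoveringNumber (R / 2 ^ k).toNNReal T ≤ ((K ^ k : ℕ) : ℕ∞) := by
  classical
  have : ProperSpace E := FiniteDimensional.proper ℝ E
  obtain ⟨R, hR, hTR⟩ := hT.subset_closedBall_lt 0 0
  obtain ⟨F, -, hFfin, hF⟩ := (isCompact_closedBall (0 : E) 1).finite_cover_balls
    (e := 1 / 2) (by norm_num)
  lift F to Finset E using hFfin
  have hcov (k : ℕ) : ∃ C : Finset E, C.card ≤ F.card ^ k ∧
      ∀ x ∈ T, ∃ y ∈ C, dist x y ≤ R / 2 ^ k := by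
    induction k with
    | zero => exact ⟨{0}, by simp, fun x hx => ⟨0, by simp, by simpa using hTR hx⟩⟩
    | succ k ih =>
      obtain ⟨C, hC, hcov⟩ := ih
      have hr : 0 < R / 2 ^ k := by positivity
      refine ⟨(C ×ˢ F).image fun z => z.1 + (R / 2 ^ k) • z.2, ?_, fun x hx => ?_⟩
      · exact Finset.card_image_le.trans (by rw [Finset.card_product, pow_succ]; gcongr)
      · obtain ⟨y, hy, hxy⟩ := hcov x hx
        have h1 : (R / 2 ^ k)⁻¹ • (x - y) ∈ Metric.closedBall (0 : E) 1 := by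
          rw [mem_closedBall_zero_iff, norm_smul, norm_inv, Real.norm_of_nonneg hr.le,
            ← dist_eq_norm, inv_mul_le_iff₀ hr]
          simpa using hxy
        obtain ⟨z, hz, hzd⟩ := Set.mem_iUnion₂.1 (hF h1)
        refine ⟨y + (R / 2 ^ k) • z, Finset.mem_image.2 ⟨(y, z), Finset.mem_product.2 ⟨hy, hz⟩, rfl⟩,
          ?_⟩
        rw [Metric.mem_ball, dist_eq_norm] at hzd
        have h2 : x - (y + (R / 2 ^ k) • z) =
            (R / 2 ^ k) • ((R / 2 ^ k)⁻¹ • (x - y) - z) := by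
          rw [smul_sub, smul_inv_smul₀ hr.ne']
          abel
        rw [dist_eq_norm, h2, norm_smul, Real.norm_of_nonneg hr.le, pow_succ, ← div_div]
        calc _ ≤ R / 2 ^ k * (1 / 2) := by gcongr
          _ = _ := by ring
  have hFne : 1 ≤ F.card := by
    obtain ⟨z, hz, -⟩ := Set.mem_iUnion₂.1 (hF (Metric.mem_closedBall_self zero_le_one))
    exact Finset.card_pos.2 ⟨z, hz⟩
  refine ⟨R, F.card, hR, hFne, fun k => ?_⟩
  obtain ⟨C, hC, hcov⟩ := hcov k
  have hcover : Metric.IsCover (R / 2 ^ k).toNNReal T (C : Set E) := by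
    refine Metric.isCover_iff_subset_iUnion_closedBall.2 fun x hx => ?_
    obtain ⟨y, hy, hxy⟩ := hcov x hx
    refine Set.mem_iUnion₂.2 ⟨y, hy, ?_⟩
    rw [Metric.mem_closedBall, Real.coe_toNNReal _ (by positivity)]
    exact hxy
  refine hcover.externalCoveringNumber_le_encard.trans ?_
  rw [Set.encard_coe_eq_coe_finsetCard]
  exact_mod_cast hC

section Entropy

variable [PseudoMetricSpace E] {T : Set E}

/-- The number of balls of radius `u` in an optimal cover of `T`, as a natural number. -/
def coverCard (T : Set E) (u : ℝ) : ℕ :=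
  (externalCoveringNumber u.toNNReal T).toNat

/-- The integrand of the Dudley integral. -/
def rootEntropy (T : Set E) (u : ℝ) : ℝ := √(Real.log (coverCard T u))

theorem rootEntropy_nonneg (u : ℝ) : 0 ≤ rootEntropy T u := Real.sqrt_nonneg _

theorem dudleyIntegral_nonneg : 0 ≤ dudleyIntegral T :=
  intervalIntegral.integral_nonneg Metric.diam_nonneg fun u _ => rootEntropy_nonneg u

theorem externalCoveringNumber_ne_top (hT : TotallyBounded T) {u : ℝ} (hu : 0 < u) :
    externalCoveringNumber u.toNNReal T ≠ ⊤ := by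
  obtain ⟨N, -, hN, hc⟩ := Metric.exists_finite_isCover_of_totallyBounded
    (Real.toNNReal_pos.2 hu).ne' hT
  exact ne_top_of_le_ne_top (Set.encard_ne_top_iff.2 hN) hc.externalCoveringNumber_le_encard

theorem coverCard_anti (hT : TotallyBounded T) {u v : ℝ} (hu : 0 < u) (huv : u ≤ v) :
    coverCard T v ≤ coverCard T u :=
  ENat.toNat_le_toNat (Metric.externalCoveringNumber_anti (Real.toNNReal_le_toNNReal huv))
    (externalCoveringNumber_ne_top hT hu)

theorem one_le_coverCard (hT : TotallyBounded T) (hne : T.Nonempty) {u : ℝ} (hu : 0 < u) :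
    1 ≤ coverCard T u := by
  rw [coverCard, Nat.one_le_iff_ne_zero, Ne, ENat.toNat_eq_zero, not_or]
  exact ⟨(Metric.externalCoveringNumber_pos_iff.2 hne).ne', externalCoveringNumber_ne_top hT hu⟩

theorem rootEntropy_antitoneOn (hT : TotallyBounded T) (hne : T.Nonempty) :
    AntitoneOn (rootEntropy T) (Set.Ioi 0) := by
  intro u hu v hv huv
  refine Real.sqrt_le_sqrt (Real.log_le_log ?_ ?_)
  · exact_mod_cast one_le_coverCard hT hne hv
  · exact_mod_cast coverCard_anti hT hu huv

/-- Below half the diameter, a single ball does not cover. -/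
theorem two_le_coverCard (hT : TotallyBounded T) (hne : T.Nonempty) {u : ℝ} (hu : 0 < u)
    (hud : u < Metric.diam T / 2) : 2 ≤ coverCard T u := by
  by_contra h
  have h1 : coverCard T u = 1 := by
    have := one_le_coverCard hT hne hu
    omega
  have h2 : externalCoveringNumber u.toNNReal T ≤ 1 := by
    rw [← ENat.natCast_toNat (externalCoveringNumber_ne_top hT hu)]
    exact_mod_cast h1.le
  have h3 : ∃ C : Set E, Metric.IsCover u.toNNReal T C ∧ C.encard ≤ 1 := by
    by_contra hcon
    push Not at hcon
    have : (2 : ℕ∞) ≤ externalCoveringNumber u.toNNReal T := by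
      refine le_iInf₂ fun C hC => ?_
      have := Order.add_one_le_of_lt (hcon C hC)
      rwa [one_add_one_eq_two] at this
    exact absurd (this.trans h2) (by decide)
  obtain ⟨C, hC, hcard⟩ := h3
  have hsub := Set.encard_le_one_iff.1 hcard
  have hCT := hC.subset_iUnion_closedBall
  rw [Real.coe_toNNReal _ hu.le] at hCT
  have : Metric.diam T ≤ 2 * u := by
    refine Metric.diam_le_of_forall_dist_le (by positivity) fun x hx y hy => ?_
    obtain ⟨c, hc, hxc⟩ := Set.mem_iUnion₂.1 (hCT hx)
    obtain ⟨d, hd, hyd⟩ := Set.mem_iUnion₂.1 (hCT hy)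
    rw [hsub d c hd hc] at hyd
    have := dist_triangle_right x y c
    rw [Metric.mem_closedBall] at hxc hyd
    linarith
  linarith

theorem integral_rootEntropy_le
    (hint : IntervalIntegrable (rootEntropy T) volume 0 (Metric.diam T))
    {a b : ℝ} (ha : 0 ≤ a) (hab : a ≤ b) (hb : b ≤ Metric.diam T) :
    ∫ u in a..b, rootEntropy T u ≤ dudleyIntegral T :=
  intervalIntegral.integral_mono_interval ha hab hb
    (Filter.Eventually.of_forall rootEntropy_nonneg) hint

theorem diam_mul_sqrt_log_two_le (hT : TotallyBounded T) (hne : T.Nonempty)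
    (hint : IntervalIntegrable (rootEntropy T) volume 0 (Metric.diam T)) :
    Metric.diam T * √(Real.log 2) ≤ 2 * dudleyIntegral T := by
  have hD : 0 ≤ Metric.diam T := Metric.diam_nonneg
  have h1 := integral_rootEntropy_le hint le_rfl (by linarith : 0 ≤ Metric.diam T / 2)
    (by linarith)
  have h2 : ∫ _ in (0 : ℝ)..Metric.diam T / 2, √(Real.log 2) ≤
      ∫ u in (0 : ℝ)..Metric.diam T / 2, rootEntropy T u := by
    refine intervalIntegral.integral_mono_on_of_le_Ioo (by linarith) (by simp)
      (hint.mono_set ?_) fun u hu => ?_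
    · rw [Set.uIcc_of_le (by linarith), Set.uIcc_of_le hD]
      exact Set.Icc_subset_Icc le_rfl (by linarith)
    · refine Real.sqrt_le_sqrt (Real.log_le_log (by norm_num) ?_)
      exact_mod_cast two_le_coverCard hT hne hu.1 hu.2
  rw [intervalIntegral.integral_const, smul_eq_mul] at h2
  linarith

/-- One dyadic term of the chaining sum is at most a piece of the Dudley integral, because the
entropy is antitone. -/
theorem mul_rootEntropy_le_integral (hT : TotallyBounded T) (hne : T.Nonempty)
    (hint : IntervalIntegrable (rootEntropy T) volume 0 (Metric.diam T))
    {a b : ℝ} (ha : 0 < a) (hab : a ≤ b)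
    (hb : b ≤ Metric.diam T) :
    (b - a) * rootEntropy T b ≤ ∫ u in a..b, rootEntropy T u := by
  rw [← smul_eq_mul, ← intervalIntegral.integral_const]
  refine intervalIntegral.integral_mono_on hab (by simp) (hint.mono_set ?_) fun u hu => ?_
  · rw [Set.uIcc_of_le hab, Set.uIcc_of_le Metric.diam_nonneg]
    exact Set.Icc_subset_Icc ha.le hb
  · exact rootEntropy_antitoneOn hT hne (ha.trans_le hu.1) (ha.trans_le hab) hu.2

end Entropy

/-- The Dudley integral of a bounded set in a finite-dimensional space converges. -/
theorem intervalIntegrable_rootEntropy [NormedAddCommGroup E] [NormedSpace ℝ E]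
    [FiniteDimensional ℝ E] {T : Set E} (hT : TotallyBounded T) (hne : T.Nonempty) :
    IntervalIntegrable (rootEntropy T) volume 0 (Metric.diam T) := by
  obtain ⟨R, K, hR, hK, hcov⟩ := exists_externalCoveringNumber_le_pow hT.isBounded
  have hlogK : 0 ≤ Real.log K := Real.log_natCast_nonneg K
  have hbound (u : ℝ) (hu : 0 < u) :
      rootEntropy T u ≤ √(Real.log K) * (√R * u ^ (-(1 / 2) : ℝ) + 1) := by
    set k : ℕ := ⌈R / u⌉₊ with hk
    have h1 : R / 2 ^ k ≤ u := by
      rw [div_le_iff₀ (by positivity), ← div_le_iff₀' hu]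
      refine (Nat.le_ceil _).trans ?_
      exact_mod_cast (Nat.lt_two_pow_self (n := k)).le
    have h2 : coverCard T u ≤ K ^ k := by
      have h3 := ENat.toNat_le_toNat (hcov k) (ENat.natCast_ne_top _)
      rw [ENat.toNat_natCast] at h3
      exact (coverCard_anti hT (by positivity) h1).trans h3
    have h4 : Real.log (coverCard T u) ≤ (R / u + 1) * Real.log K := by
      calc _ ≤ Real.log ((K : ℝ) ^ k) := Real.log_le_log
            (by exact_mod_cast one_le_coverCard hT hne hu) (by exact_mod_cast h2)
        _ = k * Real.log K := Real.log_pow _ _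
        _ ≤ _ := by gcongr; exact (Nat.ceil_lt_add_one (by positivity)).le
    calc rootEntropy T u ≤ √((R / u + 1) * Real.log K) := Real.sqrt_le_sqrt h4
      _ = √(Real.log K) * √(R / u + 1) := by rw [mul_comm, Real.sqrt_mul hlogK]
      _ ≤ √(Real.log K) * (√(R / u) + 1) := by
          gcongr
          have h5 : 0 ≤ R / u := by positivity
          rw [Real.sqrt_le_left (by positivity)]
          nlinarith [Real.sq_sqrt h5, Real.sqrt_nonneg (R / u)]
      _ = _ := by
          rw [Real.sqrt_div hR.le, Real.rpow_neg hu.le, ← Real.sqrt_eq_rpow, div_eq_mul_inv]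
  have hg : IntervalIntegrable (fun u : ℝ => √(Real.log K) * (√R * u ^ (-(1 / 2) : ℝ) + 1))
      volume 0 (Metric.diam T) :=
    (((intervalIntegral.intervalIntegrable_rpow' (by norm_num)).const_mul _).add
      (by simp)).const_mul _
  refine hg.mono_fun' ?_ ?_
  · rw [Set.uIoc_of_le Metric.diam_nonneg]
    exact (aemeasurable_restrict_of_antitoneOn measurableSet_Ioc
      ((rootEntropy_antitoneOn hT hne).mono Set.Ioc_subset_Ioi_self)).aestronglyMeasurable
  · rw [Set.uIoc_of_le Metric.diam_nonneg]
    filter_upwards [ae_restrict_mem measurableSet_Ioc] with u hu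
    rw [Real.norm_of_nonneg (rootEntropy_nonneg u)]
    exact hbound u hu.1

end MetricEntropy

/-! ### Dudley's entropy bound -/

section DudleyBound

open scoped NNReal

variable {E : Type*} [PseudoMetricSpace E] {T : Set E}

/-- Rounding to a net inside `T`. Moving the centres of the balls into `T` costs a factor `2`. -/
theorem exists_rounding (hT : TotallyBounded T) {u : ℝ} (hu : 0 < u) :
    ∃ (P : Finset T) (π : T → T), (∀ t, π t ∈ P) ∧ (∀ t, dist (π t) t ≤ 2 * u) ∧
      P.card ≤ coverCard T u := by
  classical
  have hle := Metric.coveringNumber_two_mul_le_externalCoveringNumber u.toNNReal T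
  have htop := externalCoveringNumber_ne_top hT hu
  obtain ⟨C, hCT, hCfin, hC, hcard⟩ :=
    Metric.exists_set_encard_eq_coveringNumber (ne_top_of_le_ne_top htop hle)
  rw [← hcard] at hle
  have hcov := hC.subset_iUnion_closedBall
  have hr : ((2 * u.toNNReal : ℝ≥0) : ℝ) = 2 * u := by
    rw [NNReal.coe_mul, Real.coe_toNNReal _ hu.le]; rfl
  rw [hr] at hcov
  have hex (t : T) : ∃ s : T, (s : E) ∈ C ∧ dist s t ≤ 2 * u := by
    obtain ⟨c, hc, h⟩ := Set.mem_iUnion₂.1 (hcov t.2)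
    exact ⟨⟨c, hCT hc⟩, hc, by rw [dist_comm]; exact h⟩
  choose π hπC hπ using hex
  refine ⟨hCfin.toFinset.subtype (· ∈ T), π, fun t => ?_, hπ, ?_⟩
  · simpa using hπC t
  · rw [Finset.card_subtype]
    refine (Finset.card_filter_le _ _).trans ?_
    have := ENat.toNat_le_toNat hle htop
    rwa [← hCfin.coe_toFinset, Set.encard_coe_eq_coe_finsetCard, ENat.toNat_natCast] at this

/-- **Dudley's entropy bound**, by chaining along nets of radii `diam T / 2 ^ k`. The supremum is
replaced with an integrable upper bound, so that its measurability plays no role, and the Lipschitz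
condition permits to stop the chain after finitely many steps, at the cost of `η`. -/
theorem exists_integrable_dominating_dudley (hT : TotallyBounded T)
    (hint : IntervalIntegrable (rootEntropy T) volume 0 (Metric.diam T))
    {Ω : Type*} [MeasurableSpace Ω] {μ : Measure Ω} [IsProbabilityMeasure μ]
    {Z : T → Ω → ℝ} {σ K : ℝ} (hσ : 0 < σ) (hK : 0 ≤ K)
    (hsub : ∀ s t, ∃ c : ℝ≥0, (c : ℝ) ≤ (σ * dist s t) ^ 2 ∧
      HasSubgaussianMGF (fun ω => Z s ω - Z t ω) c μ)
    (hlip : ∀ᵐ ω ∂μ, ∀ s t, |Z s ω - Z t ω| ≤ K * dist s t) (t₀ : T) {η : ℝ} (hη : 0 < η) :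
    ∃ Φ : Ω → ℝ, Integrable Φ μ ∧ (∀ᵐ ω ∂μ, ∀ t, |Z t ω - Z t₀ ω| ≤ Φ ω) ∧
      ∫ ω, Φ ω ∂μ ≤ 42 * σ * dudleyIntegral T + η := by
  classical
  have hne : T.Nonempty := ⟨t₀, t₀.2⟩
  set D := Metric.diam T with hD
  have hdist (s t : T) : dist s t ≤ D := Metric.dist_le_diam_of_mem hT.isBounded s.2 t.2
  have hDI : 0 ≤ dudleyIntegral T := dudleyIntegral_nonneg
  rcases (Metric.diam_nonneg (s := T)).eq_or_lt with hD0 | hD0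
  · refine ⟨fun _ => 0, integrable_zero _ _ _, ?_, ?_⟩
    · filter_upwards [hlip] with ω h t
      refine (h t t₀).trans ?_
      have : dist t t₀ = 0 := le_antisymm (hD0 ▸ hdist t t₀) dist_nonneg
      simp [this]
    · rw [integral_zero]; positivity
  let ε : ℕ → ℝ := fun k => D / 2 ^ k
  have hε (k) : 0 < ε k := by positivity
  have hεs (k) : ε (k + 1) = ε k / 2 := by simp only [ε, pow_succ]; field_simp
  have hεD (k) : ε k ≤ D := div_le_self hD0.le (one_le_pow₀ (by norm_num))
  have hnet (k : ℕ) : ∃ (P : Finset T) (π : T → T), (∀ t, π t ∈ P) ∧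
      (∀ t, dist (π t) t ≤ 2 * ε k) ∧ P.card ≤ coverCard T (ε k) ∧ (k = 0 → ∀ t, π t = t₀) := by
    cases k with
    | zero =>
      refine ⟨{t₀}, fun _ => t₀, by simp, fun t => ?_, ?_, by simp⟩
      · have := hdist t₀ t
        simp only [ε, pow_zero, div_one]
        linarith
      · simpa using one_le_coverCard hT hne (hε 0)
    | succ k =>
      obtain ⟨P, π, h1, h2, h3⟩ := exists_rounding hT (hε (k + 1))
      exact ⟨P, π, h1, h2, h3, by simp⟩
  choose P π hπP hπ hcard hπ0 using hnet
  let m : ℕ → ℝ := fun k => (coverCard T (ε (k + 1)) : ℝ) ^ 2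
  have hm1 (k) : (1 : ℝ) ≤ coverCard T (ε (k + 1)) := by
    exact_mod_cast one_le_coverCard hT hne (hε (k + 1))
  have hlink (k : ℕ) : ∃ Φ : Ω → ℝ, Integrable Φ μ ∧
      (∀ ω t, |Z (π (k + 1) t) ω - Z (π k t) ω| ≤ Φ ω) ∧
      ∫ ω, Φ ω ∂μ ≤ 3 * ε k * σ * √(2 * Real.log (2 * m k)) := by
    let I : Finset (T × T) := (P (k + 1) ×ˢ P k).filter fun z => dist z.1 z.2 ≤ 3 * ε k
    have hs : 0 < 3 * ε k * σ := by have := hε k; positivity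
    have hI1 (z) (hz : z ∈ I) : ∃ c : ℝ≥0, (c : ℝ) ≤ (3 * ε k * σ) ^ 2 ∧
        HasSubgaussianMGF (fun ω => Z z.1 ω - Z z.2 ω) c μ := by
      obtain ⟨c, hc, h⟩ := hsub z.1 z.2
      refine ⟨c, hc.trans ?_, h⟩
      have := (Finset.mem_filter.1 hz).2
      rw [mul_comm (3 * ε k)]
      gcongr
    have hI2 : (I.card : ℝ) ≤ m k := by
      have h6 : I.card ≤ coverCard T (ε (k + 1)) * coverCard T (ε (k + 1)) := by
        refine (Finset.card_filter_le _ _).trans ?_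
        rw [Finset.card_product]
        exact Nat.mul_le_mul (hcard _) ((hcard k).trans
          (coverCard_anti hT (hε _) (by rw [hεs]; linarith [hε k])))
      simp only [m, sq]
      exact_mod_cast h6
    obtain ⟨Φ, h1, h2, h3⟩ := exists_integrable_dominating_of_hasSubgaussianMGF (μ := μ) I
      (Y := fun z ω => Z z.1 ω - Z z.2 ω) (s := 3 * ε k * σ) (m := m k) hs hI1
          (one_le_pow₀ (hm1 k)) hI2
    refine ⟨Φ, h1, fun ω t => h2 ω (π (k + 1) t, π k t) ?_, h3⟩
    refine Finset.mem_filter.2 ⟨Finset.mem_product.2 ⟨hπP _ _, hπP _ _⟩, ?_⟩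
    have := dist_triangle_right (π (k + 1) t) (π k t) t
    have h4 := hπ (k + 1) t
    have h5 := hπ k t
    rw [hεs] at h4
    dsimp only
    linarith
  choose Φ hΦi hΦ hΦint using hlink
  obtain ⟨n, hn⟩ : ∃ n, K * (2 * ε n) ≤ η := by
    have : Filter.Tendsto (fun n : ℕ => K * (2 * (D * (1 / 2) ^ n))) Filter.atTop (nhds 0) := by
      simpa using ((tendsto_pow_atTop_nhds_zero_of_lt_one (r := (1 / 2 : ℝ))
        (by norm_num) (by norm_num)).const_mul D).const_mul 2 |>.const_mul K
    obtain ⟨n, hn⟩ := (this.eventually (gt_mem_nhds hη)).exists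
    exact ⟨n, by simpa [ε, div_eq_mul_inv] using hn.le⟩
  have hΦsum : Integrable (fun ω => ∑ k ∈ Finset.range n, Φ k ω) μ :=
    integrable_finsetSum _ fun k _ => hΦi k
  refine ⟨fun ω => (∑ k ∈ Finset.range n, Φ k ω) + η, hΦsum.add (integrable_const _), ?_, ?_⟩
  · filter_upwards [hlip] with ω h t
    have h1 : |Z t ω - Z (π n t) ω| ≤ η := by
      refine (h _ _).trans (le_trans ?_ hn)
      rw [dist_comm]
      exact mul_le_mul_of_nonneg_left (hπ n t) hK
    have h2 : Z (π n t) ω - Z t₀ ω =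
        ∑ k ∈ Finset.range n, (Z (π (k + 1) t) ω - Z (π k t) ω) := by
      rw [Finset.sum_range_sub (fun k => Z (π k t) ω), hπ0 0 rfl]
    have h3 : |Z (π n t) ω - Z t₀ ω| ≤ ∑ k ∈ Finset.range n, Φ k ω := by
      rw [h2]
      exact (Finset.abs_sum_le_sum_abs _ _).trans (Finset.sum_le_sum fun k _ => hΦ k ω t)
    have h4 := abs_sub_le (Z t ω) (Z (π n t) ω) (Z t₀ ω)
    linarith
  · have hterm (k : ℕ) : ∫ ω, Φ k ω ∂μ ≤ 3 * σ * (√2 * √(Real.log 2) * ε k +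
        8 * ∫ u in ε (k + 2)..ε (k + 1), rootEntropy T u) := by
      refine (hΦint k).trans ?_
      have h1 : √(2 * Real.log (2 * m k)) ≤
          √2 * √(Real.log 2) + 2 * rootEntropy T (ε (k + 1)) := by
        have hl : 0 ≤ Real.log (coverCard T (ε (k + 1))) := Real.log_natCast_nonneg _
        have hl2 : 0 ≤ Real.log 2 := Real.log_nonneg (by norm_num)
        rw [Real.log_mul (by norm_num) (by have := hm1 k; positivity), Real.log_pow,
          ← Real.sqrt_mul (by norm_num), rootEntropy,
          Real.sqrt_le_left (by positivity)]
        have e1 := Real.sq_sqrt hl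
        have e2 := Real.sq_sqrt (mul_nonneg zero_le_two hl2)
        have e3 : 0 ≤ √(2 * Real.log 2) * √(Real.log (coverCard T (ε (k + 1)))) := by positivity
        push_cast
        nlinarith
      have h2 := mul_rootEntropy_le_integral hT hne hint (hε (k + 2))
        (by rw [hεs (k + 1)]; linarith [hε (k + 1)]) (hεD (k + 1))
      rw [hεs (k + 1), hεs k] at h2
      have h3 : ε k * rootEntropy T (ε (k + 1)) ≤
          4 * ∫ u in ε (k + 2)..ε (k + 1), rootEntropy T u := by
        rw [hεs (k + 1), hεs k]
        linarith
      calc 3 * ε k * σ * √(2 * Real.log (2 * m k))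
          ≤ 3 * ε k * σ * (√2 * √(Real.log 2) + 2 * rootEntropy T (ε (k + 1))) := by
            have := hε k
            gcongr
        _ = 3 * σ * (√2 * √(Real.log 2) * ε k + 2 * (ε k * rootEntropy T (ε (k + 1)))) := by ring
        _ ≤ _ := mul_le_mul_of_nonneg_left (by linarith) (by positivity)
    have hsumε (n : ℕ) : ∑ k ∈ Finset.range n, ε k = 2 * D - 2 * ε n := by
      induction n with
      | zero => simp [ε]
      | succ n ih => rw [Finset.sum_range_succ, ih, hεs]; ring
    have hsumint : ∑ k ∈ Finset.range n, ∫ u in ε (k + 2)..ε (k + 1), rootEntropy T u ≤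
        dudleyIntegral T := by
      have h1 : ∑ k ∈ Finset.range n, ∫ u in ε (k + 2)..ε (k + 1), rootEntropy T u =
          ∫ u in ε (n + 1)..ε 1, rootEntropy T u := by
        have := intervalIntegral.sum_integral_adjacent_intervals (μ := volume)
          (f := rootEntropy T) (a := fun k => ε (k + 1)) (n := n) fun k _ => by
            refine hint.mono_set ?_
            rw [Set.uIcc_of_le hD0.le]
            exact Set.uIcc_subset_Icc ⟨(hε _).le, hεD _⟩ ⟨(hε _).le, hεD _⟩
        rw [intervalIntegral.integral_symm, ← this, ← Finset.sum_neg_distrib]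
        exact Finset.sum_congr rfl fun k _ => intervalIntegral.integral_symm _ _
      rw [h1]
      refine integral_rootEntropy_le hint (hε _).le ?_ (hεD _)
      simp only [ε]
      gcongr
      · norm_num
      · omega
    have hlog := diam_mul_sqrt_log_two_le hT hne hint
    rw [integral_add hΦsum (integrable_const _), integral_finsetSum _ fun k _ => hΦi k,
      integral_const, probReal_univ, one_smul]
    gcongr
    refine (Finset.sum_le_sum fun k _ => hterm k).trans ?_
    rw [← Finset.mul_sum, Finset.sum_add_distrib, ← Finset.mul_sum, ← Finset.mul_sum, hsumε]
    have hs2 : √2 ≤ 3 / 2 := by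
      rw [Real.sqrt_le_left (by norm_num)]; norm_num
    have h7 : √2 * √(Real.log 2) * (2 * D - 2 * ε n) ≤ 6 * dudleyIntegral T := by
      calc _ ≤ 3 / 2 * √(Real.log 2) * (2 * D) :=
            mul_le_mul (by gcongr) (by linarith [hε n]) (by linarith [hεD n]) (by positivity)
        _ ≤ _ := by linarith
    calc _ ≤ 3 * σ * (6 * dudleyIntegral T + 8 * dudleyIntegral T) := by gcongr
      _ = _ := by ring

end DudleyBound

/-! ### Empirical means -/

section EmpiricalMeans

open scoped NNReal

variable {Ω S ι : Type*} [MeasurableSpace S] {ρ : Measure S}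

/-- The mean of `h` over the sample points `Y i`, `i ∈ I`, minus its mean under `ρ`. -/
def empiricalDeviation (ρ : Measure S) (I : Finset ι) (Y : ι → Ω → S) (h : S → ℝ) (ω : Ω) : ℝ :=
  (I.card : ℝ)⁻¹ * ∑ i ∈ I, (h (Y i ω) - ∫ y, h y ∂ρ)

theorem empiricalDeviation_sub {I : Finset ι} {Y : ι → Ω → S} {h k : S → ℝ}
    (hh : Integrable h ρ) (hk : Integrable k ρ) (ω : Ω) :
    empiricalDeviation ρ I Y h ω - empiricalDeviation ρ I Y k ω =
      empiricalDeviation ρ I Y (fun y => h y - k y) ω := by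
  simp only [empiricalDeviation]
  rw [integral_sub hh hk, ← mul_sub, ← Finset.sum_sub_distrib]
  congr 1
  exact Finset.sum_congr rfl fun i _ => by ring

theorem empiricalDeviation_eq {I : Finset ι} (hI : I.Nonempty) (Y : ι → Ω → S) (h : S → ℝ)
    (ω : Ω) : empiricalDeviation ρ I Y h ω =
      (I.card : ℝ)⁻¹ * ∑ i ∈ I, h (Y i ω) - ∫ y, h y ∂ρ := by
  have : (I.card : ℝ) ≠ 0 := by exact_mod_cast hI.card_pos.ne'
  rw [empiricalDeviation, Finset.sum_sub_distrib, Finset.sum_const, nsmul_eq_mul, mul_sub,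
    inv_mul_cancel_left₀ this]

theorem abs_empiricalDeviation_le [IsProbabilityMeasure ρ] {I : Finset ι} (hI : I.Nonempty)
    {Y : ι → Ω → S} {h : S → ℝ} {c : ℝ} (hρ : ∀ᵐ y ∂ρ, |h y| ≤ c) {ω : Ω}
    (hY : ∀ i ∈ I, |h (Y i ω)| ≤ c) : |empiricalDeviation ρ I Y h ω| ≤ 2 * c := by
  have hcard : (0 : ℝ) < I.card := by exact_mod_cast hI.card_pos
  have h1 : |∫ y, h y ∂ρ| ≤ c := by
    simpa using norm_integral_le_of_norm_le_const (μ := ρ) (f := h) hρ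
  rw [empiricalDeviation, abs_mul, abs_inv, abs_of_pos hcard, inv_mul_le_iff₀ hcard]
  refine (Finset.abs_sum_le_sum_abs _ _).trans ?_
  rw [← nsmul_eq_mul]
  refine Finset.sum_le_card_nsmul _ _ _ fun i hi => ?_
  rw [two_mul]
  exact (abs_sub _ _).trans (add_le_add (hY i hi) h1)

variable [MeasurableSpace Ω]

theorem measurable_empiricalDeviation {Y : ι → Ω → S} (hY : ∀ i, Measurable (Y i)) {I : Finset ι}
    {h : S → ℝ} (hm : Measurable h) : Measurable (empiricalDeviation ρ I Y h) :=
  (Finset.measurable_fun_sum _ fun i _ => (hm.comp (hY i)).sub_const _).const_mul _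

variable {μ : Measure Ω} [IsProbabilityMeasure μ] {Y : ι → Ω → S}

/-- Means of independent samples have sub-Gaussian deviations, by Hoeffding's lemma. -/
theorem hasSubgaussianMGF_empiricalDeviation (hY : ∀ i, Measurable (Y i)) (hind : iIndepFun Y μ)
    (hlaw : ∀ i, μ.map (Y i) = ρ) {I : Finset ι} (hI : I.Nonempty) {h : S → ℝ}
    (hm : Measurable h) {c : ℝ} (hc : 0 ≤ c) (hbd : ∀ᵐ y ∂ρ, |h y| ≤ c) :
    ∃ v : ℝ≥0, (v : ℝ) ≤ (c / √I.card) ^ 2 ∧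
      HasSubgaussianMGF (empiricalDeviation ρ I Y h) v μ := by
  have hcard : (0 : ℝ) < I.card := by exact_mod_cast hI.card_pos
  have h1 (i : ι) : HasSubgaussianMGF (fun ω => h (Y i ω) - ∫ y, h y ∂ρ)
      ((‖c - -c‖₊ / 2) ^ 2) μ := by
    have h2 : ∀ᵐ ω ∂μ, h (Y i ω) ∈ Set.Icc (-c) c := by
      have := ae_of_ae_map (hY i).aemeasurable ((hlaw i).symm ▸ hbd)
      filter_upwards [this] with ω hω
      exact abs_le.1 hω
    have h3 := hasSubgaussianMGF_of_mem_Icc (hm.comp (hY i)).aemeasurable h2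
    rw [← hlaw i, integral_map (hY i).aemeasurable hm.aestronglyMeasurable]
    exact h3
  have h4 : iIndepFun (fun i ω => h (Y i ω) - ∫ y, h y ∂ρ) μ :=
    hind.comp (fun _ y => h y - ∫ y, h y ∂ρ) fun _ => hm.sub_const _
  have h5 := (HasSubgaussianMGF.sum_of_iIndepFun h4 (s := I) fun i _ => h1 i).const_mul
    (I.card : ℝ)⁻¹
  refine ⟨_, le_of_eq ?_, h5⟩
  change (I.card : ℝ)⁻¹ ^ 2 * ((∑ _ ∈ I, (‖c - -c‖₊ / 2) ^ 2 : ℝ≥0) : ℝ) = _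
  rw [Finset.sum_const, nsmul_eq_mul, NNReal.coe_mul, NNReal.coe_pow, NNReal.coe_div, coe_nnnorm,
    NNReal.coe_natCast, div_pow c, Real.sq_sqrt hcard.le, Real.norm_of_nonneg (by linarith),
    NNReal.coe_ofNat]
  field_simp
  ring

theorem exists_integrable_dominating_empiricalDeviation (hY : ∀ i, Measurable (Y i))
    (hind : iIndepFun Y μ) (hlaw : ∀ i, μ.map (Y i) = ρ) {I : Finset ι} (hI : I.Nonempty)
    {h : S → ℝ} (hm : Measurable h) {c : ℝ} (hc : 0 < c) (hbd : ∀ᵐ y ∂ρ, |h y| ≤ c) :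
    ∃ Φ : Ω → ℝ, Integrable Φ μ ∧ (∀ ω, |empiricalDeviation ρ I Y h ω| ≤ Φ ω) ∧
      ∫ ω, Φ ω ∂μ ≤ 2 * c / √I.card := by
  have hcard : (0 : ℝ) < I.card := by exact_mod_cast hI.card_pos
  obtain ⟨Φ, h1, h2, h3⟩ := exists_integrable_dominating_of_hasSubgaussianMGF (μ := μ)
    (Finset.univ : Finset Unit) (Y := fun _ => empiricalDeviation ρ I Y h) (s := c / √I.card)
    (m := 1) (by positivity)
    (fun _ _ => hasSubgaussianMGF_empiricalDeviation hY hind hlaw hI hm hc.le hbd) le_rfl (by simp)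
  refine ⟨Φ, h1, fun ω => h2 ω () (Finset.mem_univ _), h3.trans ?_⟩
  have h4 : √(2 * Real.log (2 * 1)) ≤ 2 := by
    rw [Real.sqrt_le_left (by norm_num)]
    linarith [Real.log_le_sub_one_of_pos (x := 2 * 1) (by norm_num)]
  rw [show 2 * c / √I.card = c / √I.card * 2 by ring]
  exact mul_le_mul_of_nonneg_left h4 (by positivity)

theorem integral_abs_empiricalDeviation_le (hY : ∀ i, Measurable (Y i))
    (hind : iIndepFun Y μ) (hlaw : ∀ i, μ.map (Y i) = ρ) {I : Finset ι} (hI : I.Nonempty)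
    {h : S → ℝ} (hm : Measurable h) {c : ℝ} (hc : 0 < c) (hbd : ∀ᵐ y ∂ρ, |h y| ≤ c) :
    ∫ ω, |empiricalDeviation ρ I Y h ω| ∂μ ≤ 2 * c / √I.card := by
  obtain ⟨Φ, h1, h2, h3⟩ :=
    exists_integrable_dominating_empiricalDeviation hY hind hlaw hI hm hc hbd
  have h4 : Integrable (empiricalDeviation ρ I Y h) μ :=
    h1.mono' (measurable_empiricalDeviation hY hm).aestronglyMeasurable
      (Filter.Eventually.of_forall h2)
  exact (integral_mono h4.abs h1 h2).trans h3

variable [IsProbabilityMeasure ρ]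

/-- Uniform deviation of empirical means over a class of bounded functions that depend on a
parameter in a Lipschitz way. -/
theorem exists_integrable_dominating_empiricalProcess {E : Type*} [PseudoMetricSpace E] {T : Set E}
    (hT : TotallyBounded T) (hint : IntervalIntegrable (rootEntropy T) volume 0 (Metric.diam T))
    (t₀ : T) (hY : ∀ i, Measurable (Y i))
    (hind : iIndepFun Y μ) (hlaw : ∀ i, μ.map (Y i) = ρ) {I : Finset ι} (hI : I.Nonempty)
    {g : T → S → ℝ} (hm : ∀ t, Measurable (g t)) {c κ : ℝ} (hc : 0 < c) (hκ : 0 < κ)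
    (hbd : ∀ t y, |g t y| ≤ c) (hlip : ∀ᵐ y ∂ρ, ∀ s t, |g s y - g t y| ≤ κ * dist s t) :
    ∃ Φ : Ω → ℝ, Integrable Φ μ ∧
      (∀ᵐ ω ∂μ, ∀ t, |empiricalDeviation ρ I Y (g t) ω| ≤ Φ ω) ∧
      ∫ ω, Φ ω ∂μ ≤ (42 * κ * dudleyIntegral T + 3 * c) / √I.card := by
  have hcard : (0 : ℝ) < I.card := by exact_mod_cast hI.card_pos
  have hgi (t) : Integrable (g t) ρ :=
    Integrable.of_bound (hm t).aestronglyMeasurable c (Filter.Eventually.of_forall (hbd t))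
  have hsub (s t : T) := empiricalDeviation_sub (I := I) (Y := Y) (hgi s) (hgi t)
  have hlipY : ∀ᵐ ω ∂μ, ∀ i ∈ I, ∀ s t, |g s (Y i ω) - g t (Y i ω)| ≤ κ * dist s t := by
    rw [Finset.eventually_all]
    intro i _
    exact ae_of_ae_map (hY i).aemeasurable ((hlaw i).symm ▸ hlip)
  have hst (s t : T) : ∀ᵐ y ∂ρ, |g s y - g t y| ≤ κ * dist s t := hlip.mono fun y hy => hy s t
  obtain ⟨Φ, h1, h2, h3⟩ := exists_integrable_dominating_dudley hT hint (μ := μ)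
    (Z := fun t => empiricalDeviation ρ I Y (g t)) (σ := κ / √I.card) (K := 2 * κ)
    (by positivity) (by positivity)
    (fun s t => by
      simp only [hsub]
      rw [div_mul_eq_mul_div]
      exact hasSubgaussianMGF_empiricalDeviation hY hind hlaw hI ((hm s).sub (hm t))
        (by positivity) (hst s t))
    (by
      filter_upwards [hlipY] with ω hω s t
      rw [hsub, mul_assoc]
      exact abs_empiricalDeviation_le hI (hst s t) fun i hi => hω i hi s t)
    t₀ (η := c / √I.card) (by positivity)
  obtain ⟨Ψ, h4, h5, h6⟩ := exists_integrable_dominating_empiricalDeviation hY hind hlaw hI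
    (hm t₀) hc (Filter.Eventually.of_forall (hbd t₀))
  refine ⟨fun ω => Φ ω + Ψ ω, h1.add h4, ?_, ?_⟩
  · filter_upwards [h2] with ω hω t
    have := abs_add_le (empiricalDeviation ρ I Y (g t) ω - empiricalDeviation ρ I Y (g t₀) ω)
      (empiricalDeviation ρ I Y (g t₀) ω)
    rw [sub_add_cancel] at this
    exact this.trans (add_le_add (hω t) (h5 ω))
  · rw [integral_add h1 h4]
    refine (add_le_add h3 h6).trans (le_of_eq ?_)
    ring

/-- The denominators of the mesh weights: for independent pairs `(U i, Y i)`, the mean of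
`k (Y j) (U i)` over `i ≠ j` is close to its conditional mean given `Y j`. -/
theorem integral_abs_leaveOneOut_le [Fintype ι] [DecidableEq ι] {U : ι → Ω → S}
    (hU : ∀ i, Measurable (U i)) (hY : ∀ i, Measurable (Y i))
    (hind : iIndepFun (fun i ω => (U i ω, Y i ω)) μ) (hlaw : ∀ i, μ.map (U i) = ρ)
    (hcard : 1 < Fintype.card ι)
    {k : S → S → ℝ} (hk : Measurable (Function.uncurry k)) {c : ℝ} (hc : 0 < c)
    (hbd : ∀ y x, |k y x| ≤ c) (j : ι) :
    Integrable (fun ω => empiricalDeviation ρ (Finset.univ.erase j) U (k (Y j ω)) ω) μ ∧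
    ∫ ω, |empiricalDeviation ρ (Finset.univ.erase j) U (k (Y j ω)) ω| ∂μ ≤
      2 * c / √(Finset.univ.erase j).card := by
  set I := Finset.univ.erase j with hIdef
  have hI : I.Nonempty := by
    rw [← Finset.card_pos, Finset.card_erase_of_mem (Finset.mem_univ _), Finset.card_univ]
    omega
  let φ : S × (I → S) → ℝ := fun z =>
    (I.card : ℝ)⁻¹ * ∑ i : I, (k z.1 (z.2 i) - ∫ x, k z.1 x ∂ρ)
  have hφω (y : S) (ω : Ω) :
      φ (y, fun i : I => U i ω) = empiricalDeviation ρ I U (k y) ω := by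
    simp only [φ, empiricalDeviation]
    rw [Finset.sum_coe_sort I (fun i => k y (U i ω) - ∫ x, k y x ∂ρ)]
  have hφm : Measurable φ := by
    refine (Finset.measurable_fun_sum _ fun i _ => Measurable.sub ?_ ?_).const_mul _
    · exact hk.comp (measurable_fst.prodMk ((measurable_pi_apply i).comp measurable_snd))
    · exact (hk.stronglyMeasurable.integral_prod_right).measurable.comp measurable_fst
  have hUm : Measurable fun ω (i : I) => U i ω := measurable_pi_iff.2 fun i => hU i
  have hindU : iIndepFun U μ := hind.comp (fun _ => Prod.fst) fun _ => measurable_fst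
  have hYU : IndepFun (Y j) (fun ω (i : I) => U i ω) μ := by
    have h1 := hind.indepFun_finset {j} I (by simp [hIdef]) fun i => (hU i).prodMk (hY i)
    exact h1.comp (φ := fun v => (v ⟨j, by simp⟩).2) (ψ := fun v i => (v i).1)
      (measurable_snd.comp (measurable_pi_apply _))
      (measurable_pi_iff.2 fun i => measurable_fst.comp (measurable_pi_apply _))
  have hmap := hYU.map_prod_eq_prod_map_map (hY j).aemeasurable hUm.aemeasurable
  have := Measure.isProbabilityMeasure_map (μ := μ) (hY j).aemeasurable
  have := Measure.isProbabilityMeasure_map (μ := μ) hUm.aemeasurable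
  have hφb (z) : |φ z| ≤ 2 * c := by
    have hcd : (0 : ℝ) < I.card := by exact_mod_cast hI.card_pos
    have h2 : |∫ x, k z.1 x ∂ρ| ≤ c := abs_integral_le_of_abs_le (hbd z.1)
    simp only [φ]
    rw [abs_mul, abs_inv, abs_of_pos hcd, inv_mul_le_iff₀ hcd]
    refine (Finset.abs_sum_le_sum_abs _ _).trans ?_
    refine (Finset.sum_le_card_nsmul _ _ (2 * c) fun i _ => ?_).trans (by simp)
    rw [two_mul]
    exact (abs_sub _ _).trans (add_le_add (hbd _ _) h2)
  have hpm : Measurable fun ω => (Y j ω, fun i : I => U i ω) := (hY j).prodMk hUm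
  have hφi : Integrable (fun z => |φ z|) (μ.map fun ω => (Y j ω, fun i : I => U i ω)) := by
    have := Measure.isProbabilityMeasure_map (μ := μ) hpm.aemeasurable
    exact (integrable_of_abs_le hφm.aemeasurable hφb).abs
  simp only [← hφω]
  refine ⟨integrable_of_abs_le (hφm.comp hpm).aemeasurable fun ω => hφb _, ?_⟩
  have h3 := integral_map hpm.aemeasurable hφi.aestronglyMeasurable
  rw [← h3]
  rw [hmap] at hφi ⊢
  rw [integral_prod _ hφi]
  refine (integral_mono (g := fun _ => 2 * c / √I.card) hφi.integral_prod_left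
    (integrable_const _) fun y => ?_).trans (by simp)
  dsimp only
  rw [integral_map (f := fun v => |φ (y, v)|) hUm.aemeasurable
    (hφm.comp (measurable_const.prodMk measurable_id)).abs.aestronglyMeasurable]
  simp only [hφω]
  exact integral_abs_empiricalDeviation_le hU hindU hlaw hI
      (hk.comp (measurable_const.prodMk measurable_id)) hc
    (Filter.Eventually.of_forall (hbd y))

end EmpiricalMeans

/-! ### Self-normalized importance sampling -/

section ImportanceSampling

variable {S : Type*} [MeasurableSpace S] {lam : Measure S}

theorem integral_withDensity_ofReal_eq {q f : S → ℝ} (hq : Measurable q) (hq0 : ∀ y, 0 ≤ q y) :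
    ∫ y, f y ∂(lam.withDensity fun y => ENNReal.ofReal (q y)) = ∫ y, q y * f y ∂lam := by
  rw [integral_withDensity_eq_integral_toReal_smul hq.ennreal_ofReal (by simp)]
  simp [ENNReal.toReal_ofReal (hq0 _)]

theorem sum_mul_normalized_eq {ι : Type*} [Fintype ι] (f r : ι → ℝ) :
    ∑ i, f i * (r i / ∑ j, r j) = (∑ i, f i * r i) / ∑ j, r j := by
  rw [Finset.sum_div]
  exact Finset.sum_congr rfl fun i _ => by ring

theorem abs_sum_mul_normalized_le {ι : Type*} [Fintype ι] [Nonempty ι] {f r : ι → ℝ} {B : ℝ}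
    (hf : ∀ i, |f i| ≤ B) (hr : ∀ i, 0 < r i) : |∑ i, f i * (r i / ∑ j, r j)| ≤ B := by
  have hR : 0 < ∑ j, r j := Finset.sum_pos (fun i _ => hr i) Finset.univ_nonempty
  rw [sum_mul_normalized_eq, abs_div, abs_of_pos hR, div_le_iff₀ hR, Finset.mul_sum]
  refine (Finset.abs_sum_le_sum_abs _ _).trans (Finset.sum_le_sum fun i _ => ?_)
  rw [abs_mul, abs_of_pos (hr i)]
  exact mul_le_mul_of_nonneg_right (hf i) (hr i).le

/-- Self-normalization: the weighted mean with weights proportional to `r i` is controlled by the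
errors of the unnormalized means of `f` and of the constant function `1`. -/
theorem abs_sum_normalized_sub_le {ι : Type*} [Fintype ι] [Nonempty ι] {f r : ι → ℝ} {B c e : ℝ}
    (hf : ∀ i, |f i| ≤ B) (hr : ∀ i, 0 < r i) :
    |∑ i, f i * (r i / ∑ j, r j) - e| ≤
      |c * ∑ i, f i * r i - e| + B * |c * ∑ i, 1 * r i - 1| := by
  have hR : 0 < ∑ j, r j := Finset.sum_pos (fun i _ => hr i) Finset.univ_nonempty
  have h2 := abs_sum_mul_normalized_le hf hr
  rw [sum_mul_normalized_eq] at h2 ⊢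
  have h3 : (∑ i, f i * r i) / ∑ j, r j - e = (c * ∑ i, f i * r i - e) -
      (∑ i, f i * r i) / (∑ j, r j) * (c * ∑ i, 1 * r i - 1) := by
    simp only [one_mul]
    field_simp
    ring
  rw [h3]
  refine (abs_sub _ _).trans ?_
  rw [abs_mul ((∑ i, f i * r i) / ∑ j, r j)]
  gcongr

variable {E : Type*} [PseudoMetricSpace E] {T : Set E} {Ω : Type*} [MeasurableSpace Ω]
  {μ : Measure Ω} [IsProbabilityMeasure μ] {ρ : Measure S} [IsProbabilityMeasure ρ]
  {N : ℕ} {U Y : Fin N → Ω → S} {k : S → S → ℝ} {p : T → S → ℝ} {f : S → ℝ} {B δ Λ κ : ℝ}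

/-- The importance sampling estimator with estimated density: uniformly in the parameter, the mean
of `f (Y n) * p t (Y n)`, divided by the estimate of the density of `Y n`, approximates the integral
of `f * p t`. The two error terms come from the empirical process at the exact density, and from
the estimation of the density. -/
theorem exists_integrable_dominating_importanceSampling (hT : TotallyBounded T)
    (hint : IntervalIntegrable (rootEntropy T) volume 0 (Metric.diam T)) (t₀ : T)
    (hN : 2 ≤ N) (hU : ∀ n, Measurable (U n)) (hY : ∀ n, Measurable (Y n))
    (hind : iIndepFun (fun n ω => (U n ω, Y n ω)) μ) (hUlaw : ∀ n, μ.map (U n) = ρ)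
    (hk : Measurable (Function.uncurry k)) (hδ : 0 < δ) (hΛ : 0 < Λ)
    (hkδ : ∀ y x, δ ≤ k y x) (hkΛ : ∀ y x, k y x ≤ Λ)
    (hYlaw : ∀ n, μ.map (Y n) = lam.withDensity fun y => ENNReal.ofReal (∫ x, k y x ∂ρ))
    (hp : ∀ t, Measurable (p t)) (hp0 : ∀ t y, 0 ≤ p t y) (hpΛ : ∀ t y, p t y ≤ Λ) (hκ : 0 < κ)
    (hlip : ∀ᵐ y ∂lam, ∀ s t, |p s y - p t y| ≤ κ * dist s t)
    (hf : Measurable f) (hB : 0 < B) (hfB : ∀ y, |f y| ≤ B) :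
    ∃ Φ : Ω → ℝ, Integrable Φ μ ∧
      (∀ᵐ ω ∂μ, ∀ t, |((N - 1 : ℕ) / N : ℝ) * ∑ n, f (Y n ω) *
          (p t (Y n ω) / ∑ i ∈ Finset.univ.erase n, k (Y n ω) (U i ω)) -
            ∫ y, f y * p t y ∂lam| ≤ Φ ω) ∧
      ∫ ω, Φ ω ∂μ ≤
        B / √N * (42 * κ * dudleyIntegral T / δ + 3 * Λ / δ + 4 * (Λ ^ 2 / δ ^ 2)) := by
  have hN0 : (0 : ℝ) < N := by exact_mod_cast (by omega : 0 < N)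
  have : Nonempty (Fin N) := ⟨⟨0, by omega⟩⟩
  have hne (n : Fin N) : (Finset.univ.erase n).card = N - 1 := by
    rw [Finset.card_erase_of_mem (Finset.mem_univ _), Finset.card_univ, Fintype.card_fin]
  have hN1 : (0 : ℝ) < (N - 1 : ℕ) := by exact_mod_cast (by omega : 0 < N - 1)
  have hki (y : S) : Integrable (k y) ρ :=
    integrable_of_abs_le (c := Λ) (hk.comp (measurable_const.prodMk measurable_id)).aemeasurable
      fun x => by rw [abs_of_nonneg (hδ.le.trans (hkδ y x))]; exact hkΛ y x
  let q : S → ℝ := fun y => ∫ x, k y x ∂ρ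
  have hq : Measurable q := (hk.stronglyMeasurable.integral_prod_right).measurable
  have hqδ (y) : δ ≤ q y := by
    simpa using integral_mono (integrable_const δ) (hki y) fun x => hkδ y x
  have hq0 (y) : 0 < q y := hδ.trans_le (hqδ y)
  let ρY : Measure S := lam.withDensity fun y => ENNReal.ofReal (q y)
  have hρY : IsProbabilityMeasure ρY := by
    have := Measure.isProbabilityMeasure_map (μ := μ) (hY (Classical.arbitrary _)).aemeasurable
    rwa [hYlaw] at this
  let g : T → S → ℝ := fun t y => f y * p t y / q y
  have hgm (t) : Measurable (g t) := (hf.mul (hp t)).div hq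
  have hgint (t) : ∫ y, g t y ∂ρY = ∫ y, f y * p t y ∂lam := by
    rw [integral_withDensity_ofReal_eq hq fun y => (hq0 y).le]
    refine integral_congr_ae (Filter.Eventually.of_forall fun y => ?_)
    exact mul_div_cancel₀ _ (hq0 y).ne'
  have hgb (t y) : |g t y| ≤ B * Λ / δ := by
    simp only [g]
    rw [abs_div, abs_mul, abs_of_nonneg (hp0 t y), abs_of_pos (hq0 y)]
    exact div_le_div₀ (by positivity)
      (mul_le_mul (hfB y) (hpΛ t y) (hp0 t y) hB.le) hδ (hqδ y)
  have hglip : ∀ᵐ y ∂ρY, ∀ s t, |g s y - g t y| ≤ B * κ / δ * dist s t := by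
    filter_upwards [(withDensity_absolutelyContinuous lam _).ae_le hlip] with y hy s t
    have h1 : g s y - g t y = f y * (p s y - p t y) / q y := by simp only [g]; ring
    rw [h1, abs_div, abs_mul, abs_of_pos (hq0 y), div_mul_eq_mul_div, mul_assoc]
    exact div_le_div₀ (by positivity)
      (mul_le_mul (hfB y) (hy s t) (abs_nonneg _) hB.le) hδ (hqδ y)
  have hindY : iIndepFun Y μ := hind.comp (fun _ => Prod.snd) fun _ => measurable_snd
  obtain ⟨Φ, h1, h2, h3⟩ := exists_integrable_dominating_empiricalProcess (ρ := ρY) hT hint t₀ hY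
    hindY hYlaw Finset.univ_nonempty hgm (c := B * Λ / δ) (κ := B * κ / δ) (by positivity)
    (by positivity) hgb hglip
  let dev : Fin N → Ω → ℝ := fun n ω =>
    empiricalDeviation ρ (Finset.univ.erase n) U (k (Y n ω)) ω
  have hdev (n) := integral_abs_leaveOneOut_le hU hY hind hUlaw
    (by rw [Fintype.card_fin]; omega) hk hΛ
    (fun y x => by rw [abs_of_nonneg (hδ.le.trans (hkδ y x))]; exact hkΛ y x) n
  have hdevi : Integrable (fun ω => ∑ n, |dev n ω|) μ :=
    integrable_finsetSum _ fun n _ => (hdev n).1.abs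
  refine ⟨fun ω => Φ ω + B * Λ / δ ^ 2 * ((N : ℝ)⁻¹ * ∑ n, |dev n ω|),
    h1.add ((hdevi.const_mul _).const_mul _), ?_, ?_⟩
  · filter_upwards [h2] with ω hω t
    have h4 := hω t
    rw [empiricalDeviation_eq Finset.univ_nonempty, hgint, Finset.card_univ, Fintype.card_fin] at h4
    have h5 : |((N - 1 : ℕ) / N : ℝ) * ∑ n, f (Y n ω) *
        (p t (Y n ω) / ∑ i ∈ Finset.univ.erase n, k (Y n ω) (U i ω)) -
        (N : ℝ)⁻¹ * ∑ n, g t (Y n ω)| ≤ B * Λ / δ ^ 2 * ((N : ℝ)⁻¹ * ∑ n, |dev n ω|) := by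
      rw [div_mul_eq_mul_div, div_eq_inv_mul, ← mul_sub, abs_mul, abs_inv, abs_of_pos hN0,
        mul_left_comm]
      refine mul_le_mul_of_nonneg_left ?_ (by positivity)
      rw [Finset.mul_sum, ← Finset.sum_sub_distrib, Finset.mul_sum]
      refine (Finset.abs_sum_le_sum_abs _ _).trans (Finset.sum_le_sum fun n _ => ?_)
      set y := Y n ω
      set Q := ∑ i ∈ Finset.univ.erase n, k y (U i ω) with hQ
      have hQδ : (N - 1 : ℕ) * δ ≤ Q := by
        have := Finset.card_nsmul_le_sum (Finset.univ.erase n) (fun i => k y (U i ω)) δ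
          fun i _ => hkδ _ _
        rwa [hne, nsmul_eq_mul] at this
      have hd : dev n ω = Q / (N - 1 : ℕ) - q y := by
        simp only [dev]
        rw [empiricalDeviation_eq (by rw [← Finset.card_pos, hne]; omega), hne, inv_mul_eq_div]
      set D := Q / (N - 1 : ℕ) with hD
      have hDδ : δ ≤ D := by rw [hD, le_div_iff₀ hN1, mul_comm]; exact hQδ
      have hD0 : 0 < D := hδ.trans_le hDδ
      have h6 : (N - 1 : ℕ) * (f y * (p t y / Q)) - g t y = f y * p t y * (q y - D) /
          (D * q y) := by
        have hQD : Q = (N - 1 : ℕ) * D := by rw [hD]; field_simp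
        have := (hq0 y).ne'
        simp only [g]
        rw [hQD]
        field_simp
      rw [h6, hd, abs_div, abs_mul, abs_mul, abs_of_nonneg (hp0 t y), abs_sub_comm (q y),
        abs_of_pos (mul_pos hD0 (hq0 y)), div_mul_eq_mul_div (B * Λ)]
      apply div_le_div₀
      · positivity
      · exact mul_le_mul_of_nonneg_right (mul_le_mul (hfB y) (hpΛ t y) (hp0 t y) hB.le)
          (abs_nonneg _)
      · positivity
      · rw [sq]; exact mul_le_mul hDδ (hqδ y) hδ.le hD0.le
    have h7 := abs_sub_le (((N - 1 : ℕ) / N : ℝ) * ∑ n, f (Y n ω) *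
        (p t (Y n ω) / ∑ i ∈ Finset.univ.erase n, k (Y n ω) (U i ω)))
        ((N : ℝ)⁻¹ * ∑ n, g t (Y n ω)) (∫ y, f y * p t y ∂lam)
    linarith
  · rw [integral_add h1 ((hdevi.const_mul _).const_mul _), integral_const_mul, integral_const_mul,
      integral_finsetSum _ fun n _ => (hdev n).1.abs]
    rw [Finset.card_univ, Fintype.card_fin] at h3
    have h8 : 2 * Λ / √(N - 1 : ℕ) ≤ 4 * Λ / √N := by
      have h9 : √N ≤ 2 * √(N - 1 : ℕ) := by
        rw [Real.sqrt_le_left (by positivity), mul_pow, Real.sq_sqrt hN1.le]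
        have : N ≤ 4 * (N - 1) := by omega
        norm_num
        exact_mod_cast this
      rw [div_le_div_iff₀ (by positivity) (by positivity)]
      nlinarith
    have h10 : (N : ℝ)⁻¹ * ∑ n, ∫ ω, |dev n ω| ∂μ ≤ 4 * Λ / √N := by
      rw [inv_mul_le_iff₀ hN0]
      refine (Finset.sum_le_card_nsmul _ _ (4 * Λ / √N) fun n _ => ?_).trans (by simp)
      have := (hdev n).2
      rw [hne] at this
      exact this.trans h8
    refine (add_le_add h3 (mul_le_mul_of_nonneg_left h10 (by positivity))).trans (le_of_eq ?_)
    field_simp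

/-- The same for the self-normalized estimator. -/
theorem exists_integrable_dominating_selfNormalized (hT : TotallyBounded T)
    (hint : IntervalIntegrable (rootEntropy T) volume 0 (Metric.diam T)) (t₀ : T)
    (hN : 2 ≤ N) (hU : ∀ n, Measurable (U n)) (hY : ∀ n, Measurable (Y n))
    (hind : iIndepFun (fun n ω => (U n ω, Y n ω)) μ) (hUlaw : ∀ n, μ.map (U n) = ρ)
    (hk : Measurable (Function.uncurry k)) (hδ : 0 < δ) (hΛ : 0 < Λ)
    (hkδ : ∀ y x, δ ≤ k y x) (hkΛ : ∀ y x, k y x ≤ Λ)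
    (hYlaw : ∀ n, μ.map (Y n) = lam.withDensity fun y => ENNReal.ofReal (∫ x, k y x ∂ρ))
    (hp : ∀ t, Measurable (p t)) (hp0 : ∀ t y, 0 < p t y) (hpΛ : ∀ t y, p t y ≤ Λ)
    (hp1 : ∀ t, ∫ y, p t y ∂lam = 1) (hκ : 0 < κ)
    (hlip : ∀ᵐ y ∂lam, ∀ s t, |p s y - p t y| ≤ κ * dist s t)
    (hf : Measurable f) (hfB : ∀ y, |f y| ≤ B) :
    ∃ Φ : Ω → ℝ, Integrable Φ μ ∧
      (∀ᵐ ω ∂μ, ∀ t, |∑ n, f (Y n ω) *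
          ((p t (Y n ω) / ∑ i ∈ Finset.univ.erase n, k (Y n ω) (U i ω)) /
            ∑ m, p t (Y m ω) / ∑ i ∈ Finset.univ.erase m, k (Y m ω) (U i ω)) -
            ∫ y, f y * p t y ∂lam| ≤ Φ ω) ∧
      ∫ ω, Φ ω ∂μ ≤
        2 * (B / √N * (42 * κ * dudleyIntegral T / δ + 3 * Λ / δ + 4 * (Λ ^ 2 / δ ^ 2))) := by
  have : Nonempty (Fin N) := ⟨⟨0, by omega⟩⟩
  have hB0 : 0 ≤ B := by
    have := Measure.isProbabilityMeasure_map (μ := μ) (hY (Classical.arbitrary _)).aemeasurable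
    obtain ⟨y⟩ := nonempty_of_isProbabilityMeasure (μ.map (Y (Classical.arbitrary _)))
    exact (abs_nonneg _).trans (hfB y)
  rcases hB0.eq_or_lt with rfl | hB
  · have hf0 (y) : f y = 0 := abs_nonpos_iff.1 (hfB y)
    exact ⟨fun _ => 0, integrable_zero _ _ _, by simp [hf0], by simp⟩
  obtain ⟨Φ, h1, h2, h3⟩ := exists_integrable_dominating_importanceSampling hT hint t₀ hN hU hY hind
    hUlaw hk hδ hΛ hkδ hkΛ hYlaw hp (fun t y => (hp0 t y).le) hpΛ hκ hlip hf hB hfB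
  obtain ⟨Ψ, h4, h5, h6⟩ := exists_integrable_dominating_importanceSampling
      (f := fun _ => 1) hT hint
    t₀ hN hU hY hind hUlaw hk hδ hΛ hkδ hkΛ hYlaw hp (fun t y => (hp0 t y).le) hpΛ hκ hlip
    measurable_const one_pos (by simp)
  refine ⟨fun ω => Φ ω + B * Ψ ω, h1.add (h4.const_mul _), ?_, ?_⟩
  · filter_upwards [h2, h5] with ω hω hω' t
    have h7 := hω' t
    simp only [one_mul, hp1] at h7
    have hr (n : Fin N) : 0 < p t (Y n ω) / ∑ i ∈ Finset.univ.erase n, k (Y n ω) (U i ω) := by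
      refine div_pos (hp0 _ _) (Finset.sum_pos (fun i _ => hδ.trans_le (hkδ _ _)) ?_)
      rw [← Finset.card_pos, Finset.card_erase_of_mem (Finset.mem_univ _), Finset.card_univ,
        Fintype.card_fin]
      omega
    refine (abs_sum_normalized_sub_le (c := ((N - 1 : ℕ) / N : ℝ)) (fun n => hfB _) hr).trans ?_
    simp only [one_mul]
    gcongr
    exact hω t
  · rw [integral_add h1 (h4.const_mul _), integral_const_mul, two_mul]
    refine add_le_add h3 ((mul_le_mul_of_nonneg_left h6 hB.le).trans (le_of_eq ?_))
    ring

end ImportanceSampling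

/-! ### The backward recursion of the mesh algorithm -/

namespace MDP

section Backward

variable {S A : Type*} {p : ℕ → A → S → S → ℝ} {b : ℕ → A} {N : ℕ} {δ : ℝ}

theorem meshRatio_pos (hN : 2 ≤ N) (hδ : 0 < δ) {t : ℕ} (hp : ∀ a y x, δ ≤ p (t + 1) a y x)
    (s : Fin N → ℕ → S) (n : Fin N) (x : S) (a : A) : 0 < meshRatio p b s t n x a := by
  refine div_pos (hδ.trans_le (hp _ _ _))
    (Finset.sum_pos (fun k _ => hδ.trans_le (hp _ _ _)) ?_)
  rw [← Finset.card_pos, Finset.card_erase_of_mem (Finset.mem_univ _), Finset.card_univ,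
    Fintype.card_fin]
  omega

theorem abs_meshExpect_le (hN : 2 ≤ N) (hδ : 0 < δ) {t : ℕ} (hp : ∀ a y x, δ ≤ p (t + 1) a y x)
    (s : Fin N → ℕ → S) {f : S → ℝ} {c : ℝ} (hf : ∀ n, |f (s n (t + 1))| ≤ c) (x : S) (a : A) :
    |meshExpect p b s t f x a| ≤ c := by
  have : Nonempty (Fin N) := ⟨⟨0, by omega⟩⟩
  exact abs_sum_mul_normalized_le hf fun n => meshRatio_pos hN hδ hp s n x a

theorem meshExpect_congr {s s' : Fin N → ℕ → S} {t : ℕ} (h0 : ∀ n, s n t = s' n t)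
    (h1 : ∀ n, s n (t + 1) = s' n (t + 1)) (f : S → ℝ) (x : S) (a : A) :
    meshExpect p b s t f x a = meshExpect p b s' t f x a := by
  simp only [meshExpect, meshWeight, meshRatio, h0, h1]

variable [MeasurableSpace S] [MeasurableSpace A]

theorem measurable_meshRatio {t : ℕ}
    (hp : Measurable fun z : A × S × S => p (t + 1) z.1 z.2.1 z.2.2)
    {ξ : (Fin N → ℕ → S) → S} (hξ : Measurable ξ) (n : Fin N) :
    Measurable fun z : (Fin N → ℕ → S) × A => meshRatio p b z.1 t n (ξ z.1) z.2 := by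
  have hev (k : Fin N) (i : ℕ) : Measurable fun z : (Fin N → ℕ → S) × A => z.1 k i :=
    (measurable_pi_apply i).comp ((measurable_pi_apply k).comp measurable_fst)
  refine Measurable.div ?_ (Finset.measurable_fun_sum _ fun k _ => ?_)
  · exact hp.comp (measurable_snd.prodMk ((hev n _).prodMk (hξ.comp measurable_fst)))
  · exact hp.comp (measurable_const.prodMk ((hev n _).prodMk (hev k _)))

variable {M : MDP S A} {G : ℝ}

theorem abs_meshValueAux_le [Nonempty A] (hN : 2 ≤ N) (hδ : 0 < δ)
    (hp : ∀ t, 1 ≤ t → t ≤ M.H → ∀ a y x, δ ≤ p t a y x)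
    (hR : ∀ t, t < M.H → ∀ x a, |M.R t x a| ≤ G) (hF : ∀ x, |M.F x| ≤ G)
    (s : Fin N → ℕ → S) {m : ℕ} (hm : m ≤ M.H) (x : S) :
    |M.meshValueAux p b s m x| ≤ (m + 1) * G := by
  induction m generalizing x with
  | zero => simpa [meshValueAux] using hF x
  | succ m ih =>
    refine abs_ciSup_le fun a => (abs_add_le _ _).trans ((add_le_add (hR _ (by omega) _ _)
      (abs_meshExpect_le hN hδ (hp _ (by omega) (by omega)) s
        (fun n => ih (by omega) _) x a)).trans (le_of_eq ?_))
    push_cast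
    ring

/-- The errors of the approximate conditional expectations add up along the backward recursion,
because the mesh weights are nonnegative with sum `1`. -/
theorem abs_meshValueAux_sub_dpValueAux_le [Nonempty A] (hN : 2 ≤ N) (hδ : 0 < δ)
    (hp : ∀ t, 1 ≤ t → t ≤ M.H → ∀ a y x, δ ≤ p t a y x)
    (hR : ∀ t, t < M.H → ∀ x a, |M.R t x a| ≤ G) (hF : ∀ x, |M.F x| ≤ G)
    (s : Fin N → ℕ → S) {e : ℕ → ℝ}
    (he : ∀ t, t < M.H → ∀ x a, |meshExpect p b s t (M.dpValue (t + 1)) x a -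
      ∫ y, M.dpValue (t + 1) y ∂M.P (t + 1) (x, a)| ≤ e t) {m : ℕ} (hm : m ≤ M.H) (x : S) :
    |M.meshValueAux p b s m x - M.dpValueAux m x| ≤
      ∑ j ∈ Finset.range m, e (M.H - (j + 1)) := by
  induction m generalizing x with
  | zero => simp [meshValueAux, dpValueAux]
  | succ m ih =>
    set t := M.H - (m + 1) with ht
    have hdp : M.dpValue (t + 1) = M.dpValueAux m := by
      rw [dpValue, show M.H - (t + 1) = m by omega]
    have hpt := hp (t + 1) (by omega) (by omega)
    rw [Finset.sum_range_succ]
    refine abs_iSup_sub_iSup_le ?_ fun a => ?_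
    · exact ⟨_, by
        rintro _ ⟨a, rfl⟩
        exact (abs_le.1 ((abs_add_le _ _).trans (add_le_add (hR _ (by omega) _ _)
          (abs_integral_le_of_abs_le (abs_dpValueAux_le hR hF (by omega : m ≤ M.H)))))).2⟩
    · have h1 := he t (by omega) x a
      rw [hdp] at h1
      have h2 : meshExpect p b s t (M.meshValueAux p b s m) x a -
          meshExpect p b s t (M.dpValueAux m) x a =
          meshExpect p b s t (fun y => M.meshValueAux p b s m y - M.dpValueAux m y) x a := by
        simp only [meshExpect, ← Finset.sum_sub_distrib, sub_mul]
      have h3 := abs_meshExpect_le (b := b) hN hδ hpt s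
        (f := fun y => M.meshValueAux p b s m y - M.dpValueAux m y)
        (fun n => ih (by omega) (s n (t + 1))) x a
      rw [← h2] at h3
      have h4 := abs_sub_le (meshExpect p b s t (M.meshValueAux p b s m) x a)
        (meshExpect p b s t (M.dpValueAux m) x a) (∫ y, M.dpValueAux m y ∂M.P (t + 1) (x, a))
      rw [add_sub_add_left_eq_sub]
      linarith

theorem meshValueAux_congr {s s' : Fin N → ℕ → S} (h : ∀ n, ∀ t ≤ M.H, s n t = s' n t) {m : ℕ}
    (hm : m ≤ M.H) : M.meshValueAux p b s m = M.meshValueAux p b s' m := by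
  induction m with
  | zero => rfl
  | succ m ih =>
    funext x
    simp only [meshValueAux, ih (by omega)]
    congr 1
    funext a
    rw [meshExpect_congr (fun n => h n _ (by omega)) fun n => h n _ (by omega)]

section Measurability

variable [TopologicalSpace S] [PolishSpace S] [BorelSpace S]
  [TopologicalSpace A] [PolishSpace A] [BorelSpace A]

/-- The value computed by the mesh algorithm is a measurable function of the simulated states, up to
a null set. The recursion evaluates `V̄_{t+1}` only at the simulated states, so these values can be
replaced with Borel functions before the supremum over the actions is taken. -/
theorem aemeasurable_meshValueAux [Nonempty A] (hN : 2 ≤ N) (hδ : 0 < δ)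
    (hpm : ∀ t, 1 ≤ t → t ≤ M.H → Measurable fun z : A × S × S => p t z.1 z.2.1 z.2.2)
    (hp : ∀ t, 1 ≤ t → t ≤ M.H → ∀ a y x, δ ≤ p t a y x)
    (hR : ∀ t, t < M.H → ∀ x a, |M.R t x a| ≤ G) (hF : ∀ x, |M.F x| ≤ G) (hG : 0 ≤ G)
    (ν : Measure (Fin N → ℕ → S)) [IsFiniteMeasure ν] {m : ℕ} (hm : m ≤ M.H)
    {ξ : (Fin N → ℕ → S) → S} (hξ : Measurable ξ) :
    AEMeasurable (fun s => M.meshValueAux p b s m (ξ s)) ν := by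
  induction m generalizing ξ with
  | zero => exact (M.measurable_F.comp hξ).aemeasurable
  | succ m ih =>
    set t := M.H - (m + 1) with ht
    have hv (n : Fin N) : ∃ v : (Fin N → ℕ → S) → ℝ, Measurable v ∧
        Set.range v ⊆ Set.Icc (-((m + 1) * G)) ((m + 1) * G) ∧
        (fun s => M.meshValueAux p b s m (s n (t + 1))) =ᵐ[ν] v := by
      refine (ih (by omega) ((measurable_pi_apply _).comp
        (measurable_pi_apply n))).exists_ae_eq_range_subset
        (Filter.Eventually.of_forall fun s => ?_) (Set.nonempty_Icc.2 ?_)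
      · exact abs_le.1 (abs_meshValueAux_le hN hδ hp hR hF s (by omega) _)
      · have : 0 ≤ (m + 1) * G := by positivity
        linarith
    choose v hvm hvr hva using hv
    let f : (Fin N → ℕ → S) × A → ℝ := fun z => M.R t (ξ z.1) z.2 +
      ∑ n, v n z.1 * meshWeight p b z.1 t n (ξ z.1) z.2
    have hratio (n : Fin N) := measurable_meshRatio (b := b)
        (hpm (t + 1) (by omega) (by omega)) hξ n
    have hf : Measurable f := by
      refine Measurable.add ?_ (Finset.measurable_fun_sum _ fun n _ => ?_)
      · exact (M.measurable_R t).comp ((hξ.comp measurable_fst).prodMk measurable_snd)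
      · exact ((hvm n).comp measurable_fst).mul
          ((hratio n).div (Finset.measurable_fun_sum _ fun k _ => hratio k))
    have hne : Nonempty (Fin N) := ⟨⟨0, by omega⟩⟩
    have hb (s) : BddAbove (Set.range fun a => f (s, a)) := by
      refine ⟨G + (m + 1) * G, ?_⟩
      rintro _ ⟨a, rfl⟩
      refine (abs_le.1 ((abs_add_le _ _).trans (add_le_add (hR t (by omega) _ _) ?_))).2
      exact abs_sum_mul_normalized_le (fun n => abs_le.2 (hvr n ⟨s, rfl⟩))
        fun n => meshRatio_pos hN hδ (hp _ (by omega) (by omega)) s n (ξ s) a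
    refine (aemeasurable_iSup_of_measurable_prod ν hf hb).congr ?_
    have hall : ∀ᵐ s ∂ν, ∀ n, M.meshValueAux p b s m (s n (t + 1)) = v n s :=
      ae_all_iff.2 hva
    filter_upwards [hall] with s hs
    simp only [meshValueAux, meshExpect, f, ← ht, hs]

end Measurability

end Backward

end MDP

/-! ### Regular densities and the error of one step -/

section Euclidean

variable {dS dA : ℕ} {S : Set (EuclideanSpace ℝ (Fin dS))} {A : Set (EuclideanSpace ℝ (Fin dA))}

theorem isFiniteMeasure_lebesgueOn (hS : IsCompact S) : IsFiniteMeasure (lebesgueOn S) := by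
  refine ⟨?_⟩
  rw [lebesgueOn, (MeasurableEmbedding.subtype_coe hS.measurableSet).comap_apply, Set.image_univ,
    Subtype.range_coe]
  exact hS.measure_lt_top

theorem totallyBounded_euclideanProd (hS : IsCompact S) (hA : IsCompact A) :
    TotallyBounded (euclideanProd S A) := by
  have : euclideanProd S A = WithLp.toLp 2 '' (S ×ˢ A) := by
    ext z
    constructor
    · intro hz
      exact ⟨(z.fst, z.snd), hz, rfl⟩
    · rintro ⟨w, hw, rfl⟩
      exact hw
  rw [this]
  exact ((hS.prod hA).image (WithLp.prod_continuous_toLp _ _ _)).totallyBounded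

namespace MDP

variable {M : MDP S A} {p : ℕ → A → S → S → ℝ} {ℓ : S → ℝ} {δ Λ L G : ℝ}

namespace IsRegular

theorem measurable_uncurry (hM : M.IsRegular p ℓ δ Λ L G) {t : ℕ} (h1 : 1 ≤ t) (hH : t ≤ M.H) :
    Measurable fun z : A × S × S => p t z.1 z.2.1 z.2.2 := by
  have h : Measurable (Function.uncurry fun (z : A × S) (y : S) => p t z.1 y z.2) := by
    refine measurable_uncurry_of_continuous_of_measurable (fun y => ?_)
      fun z => hM.measurable_density t h1 hH z.1 z.2
    refine (LipschitzWith.of_dist_le_mul (K := (2 * ℓ y).toNNReal) fun z w => ?_).continuous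
    have hℓ := hM.ell_nonneg y
    rw [Real.coe_toNNReal _ (by positivity), Real.dist_eq]
    refine (hM.lipschitz t h1 hH _ _ _ _ _).trans ?_
    have h2 : dist z.1 w.1 ≤ dist z w := le_max_left _ _
    have h3 : dist z.2 w.2 ≤ dist z w := le_max_right _ _
    nlinarith
  exact h.comp ((measurable_fst.prodMk (measurable_snd.comp measurable_snd)).prodMk
    (measurable_fst.comp measurable_snd))

theorem nonneg (hM : M.IsRegular p ℓ δ Λ L G) {t : ℕ} (h1 : 1 ≤ t) (hH : t ≤ M.H) (a : A)
    (y x : S) : 0 ≤ p t a y x :=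
  hM.delta_pos.le.trans (hM.lower t h1 hH a y x)

theorem integral_eq (hM : M.IsRegular p ℓ δ Λ L G) {t : ℕ} (h1 : 1 ≤ t) (hH : t ≤ M.H) (a : A)
    (x : S) (f : S → ℝ) :
    ∫ y, f y ∂M.P t (x, a) = ∫ y, f y * p t a y x ∂lebesgueOn S := by
  rw [hM.density t h1 hH, integral_withDensity_ofReal_eq (hM.measurable_density t h1 hH a x)
    fun y => hM.nonneg h1 hH a y x]
  simp only [mul_comm]

theorem absolutelyContinuous (hM : M.IsRegular p ℓ δ Λ L G) {t : ℕ} (h1 : 1 ≤ t) (hH : t ≤ M.H)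
    (z : S × A) :
    M.P t z ≪ lebesgueOn S := by
  rw [show z = (z.1, z.2) from rfl, hM.density t h1 hH]
  exact withDensity_absolutelyContinuous _ _

theorem ae_ell_le (hM : M.IsRegular p ℓ δ Λ L G) : ∀ᵐ y ∂lebesgueOn S, ℓ y ≤ L := by
  filter_upwards [ae_le_eLpNormEssSup (f := ℓ) (μ := lebesgueOn S)] with y hy
  have h := hy.trans ((eLpNorm_exponent_top (f := ℓ)).symm.le.trans hM.ell_top)
  rw [Real.enorm_of_nonneg (hM.ell_nonneg y)] at h
  exact (ENNReal.ofReal_le_ofReal_iff hM.L_nonneg).1 h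

/-- After an open-loop step, the state has the mixture of the transition densities as density. -/
theorem openLoopKernel_comp_eq (hM : M.IsRegular p ℓ δ Λ L G) (hS : IsCompact S) (b : ℕ → A)
    {t : ℕ} (ht : t < M.H)
    (ρ : Measure S) [IsProbabilityMeasure ρ] :
    M.openLoopKernel b t ∘ₘ ρ =
      (lebesgueOn S).withDensity fun y => ENNReal.ofReal (∫ x, p (t + 1) (b t) y x ∂ρ) := by
  have := isFiniteMeasure_lebesgueOn hS
  have hpm := hM.measurable_uncurry (t := t + 1) (by omega) ht
  have hk : Measurable (Function.uncurry fun x y => ENNReal.ofReal (p (t + 1) (b t) y x)) :=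
    (hpm.comp (measurable_const.prodMk (measurable_snd.prodMk measurable_fst))).ennreal_ofReal
  ext s hs
  rw [Measure.bind_apply hs (by fun_prop), withDensity_apply _ hs]
  have h1 (x : S) : M.openLoopKernel b t x s =
      ∫⁻ y in s, ENNReal.ofReal (p (t + 1) (b t) y x) ∂lebesgueOn S := by
    rw [openLoopKernel, Kernel.comap_apply, hM.density _ (by omega) ht, withDensity_apply _ hs]
  simp only [h1]
  rw [lintegral_lintegral_swap hk.aemeasurable]
  refine lintegral_congr fun y => ?_
  rw [ofReal_integral_eq_lintegral_ofReal]
  · exact integrable_of_abs_le (c := Λ)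
      (hpm.comp (measurable_const.prodMk (measurable_const.prodMk measurable_id))).aemeasurable
      fun x => by
        rw [abs_of_nonneg (hM.nonneg (by omega) ht _ _ _)]
        exact hM.upper _ (by omega) ht _ _ _
  · exact Filter.Eventually.of_forall fun x => hM.nonneg (by omega) ht _ _ _

end IsRegular

theorem IsMeshSample.map_eq {b : ℕ → A} {x₀ : S} {N : ℕ} {Ω : Type*} [MeasurableSpace Ω]
    {μ : Measure Ω} {X : Fin N → ℕ → Ω → S} (hX : M.IsMeshSample b x₀ μ X) (n : Fin N) {t : ℕ}
    (ht : t ≤ M.H) : μ.map (X n t) = (M.openLoopLaw b x₀).map fun w => w t := by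
  have h1 : Measurable fun ω (i : Finset.Iic M.H) => X n i ω :=
    measurable_pi_iff.2 fun i => hX.measurable n i (Finset.mem_Iic.1 i.2)
  have h2 : Measurable fun v : Finset.Iic M.H → S => v ⟨t, Finset.mem_Iic.2 ht⟩ :=
    measurable_pi_apply _
  have h3 := congrArg (Measure.map fun v : Finset.Iic M.H → S => v ⟨t, Finset.mem_Iic.2 ht⟩)
    (hX.law n)
  rw [Measure.map_map h2 h1, Measure.map_map h2 (by fun_prop)] at h3
  exact h3

/-- One step of the mesh algorithm: uniform error of the approximate conditional expectations of a
fixed bounded function. -/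
theorem exists_integrable_dominating_meshExpect (hS : IsCompact S) (hA : IsCompact A)
    (hM : M.IsRegular p ℓ δ Λ L G) {b : ℕ → A} {x₀ : S} {N : ℕ} (hN : 2 ≤ N) {Ω : Type*}
    [MeasurableSpace Ω] {μ : Measure Ω} [IsProbabilityMeasure μ] {X : Fin N → ℕ → Ω → S}
    (hX : M.IsMeshSample b x₀ μ X) {t : ℕ} (ht : t < M.H) {f : S → ℝ} {B : ℝ}
    (hf : AEMeasurable f (lebesgueOn S)) (hfB : ∀ y, |f y| ≤ B) :
    ∃ Φ : Ω → ℝ, Integrable Φ μ ∧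
      (∀ᵐ ω ∂μ, ∀ x a, |meshExpect p b (fun n h => X n h ω) t f x a -
        ∫ y, f y ∂M.P (t + 1) (x, a)| ≤ Φ ω) ∧
      ∫ ω, Φ ω ∂μ ≤ 126 * (B / √N * ((L * dudleyIntegral (euclideanProd S A) + Λ) / δ +
        Λ ^ 2 / δ ^ 2)) := by
  have hfin := isFiniteMeasure_lebesgueOn hS
  have hδ := hM.delta_pos
  have hΛ := hM.Lambda_pos
  have hL := hM.L_nonneg
  have h1 : 1 ≤ t + 1 := by omega
  set T := euclideanProd S A with hTdef
  have hT : TotallyBounded T := totallyBounded_euclideanProd hS hA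
  let t₀ : T :=
      ⟨WithLp.toLp 2 ((x₀ : EuclideanSpace ℝ (Fin dS)), (b 0 : EuclideanSpace ℝ (Fin dA))),
    x₀.2, (b 0).2⟩
  have hint : IntervalIntegrable (rootEntropy T) volume 0 (Metric.diam T) :=
    intervalIntegrable_rootEntropy hT ⟨t₀, t₀.2⟩
  have hDI : 0 ≤ dudleyIntegral T := dudleyIntegral_nonneg
  let st : T → S := fun θ => ⟨θ.1.fst, θ.2.1⟩
  let ac : T → A := fun θ => ⟨θ.1.snd, θ.2.2⟩
  let pT : T → S → ℝ := fun θ y => p (t + 1) (ac θ) y (st θ)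
  -- A positive Lipschitz constant whose product with the Dudley integral is still of the right size.
  set κ : ℝ := √2 * (L + Λ / (dudleyIntegral T + 1)) with hκdef
  have hκ : 0 < κ := by positivity
  have hlip : ∀ᵐ y ∂lebesgueOn S, ∀ θ θ', |pT θ y - pT θ' y| ≤ κ * dist θ θ' := by
    filter_upwards [hM.ae_ell_le] with y hy θ θ'
    have hd : dist (st θ) (st θ') + dist (ac θ) (ac θ') ≤ √2 * dist θ θ' := by
      have h2 : dist θ θ' = √(dist (st θ) (st θ') ^ 2 + dist (ac θ) (ac θ') ^ 2) :=
        WithLp.prod_dist_eq_of_L2 θ.1 θ'.1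
      rw [h2, ← Real.sqrt_mul zero_le_two]
      refine Real.le_sqrt_of_sq_le ?_
      nlinarith [sq_nonneg (dist (st θ) (st θ') - dist (ac θ) (ac θ'))]
    have hL' : ℓ y ≤ L + Λ / (dudleyIntegral T + 1) :=
      hy.trans (le_add_of_nonneg_right (by positivity))
    calc |pT θ y - pT θ' y| ≤ ℓ y * (dist (st θ) (st θ') + dist (ac θ) (ac θ')) :=
          hM.lipschitz _ h1 ht _ _ _ _ _
      _ ≤ (L + Λ / (dudleyIntegral T + 1)) * (√2 * dist θ θ') :=
          mul_le_mul hL' hd (by positivity) (by positivity)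
      _ = κ * dist θ θ' := by rw [hκdef]; ring
  have hpm := hM.measurable_uncurry h1 ht
  have hXm (n : Fin N) (i : ℕ) (hi : i ≤ M.H) : Measurable (X n i) := hX.measurable n i hi
  let ρ : Measure S := (M.openLoopLaw b x₀).map fun w => w t
  have : IsProbabilityMeasure (M.openLoopLaw b x₀) := by unfold openLoopLaw; infer_instance
  have hρ : IsProbabilityMeasure ρ :=
    Measure.isProbabilityMeasure_map (measurable_pi_apply t).aemeasurable
  have hYlaw (n : Fin N) : μ.map (X n (t + 1)) = (lebesgueOn S).withDensity fun y =>
      ENNReal.ofReal (∫ x, p (t + 1) (b t) y x ∂ρ) := by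
    rw [hX.map_eq n ht, ← hM.openLoopKernel_comp_eq hS b ht]
    exact markovPathLaw_map_succ _ _ t
  have hind : iIndepFun (fun n ω => (X n t ω, X n (t + 1) ω)) μ :=
    hX.indep.comp (fun _ v => (v ⟨t, Finset.mem_Iic.2 ht.le⟩, v ⟨t + 1, Finset.mem_Iic.2 ht⟩))
      fun _ => (measurable_pi_apply _).prodMk (measurable_pi_apply _)
  have hp1 (θ : T) : ∫ y, pT θ y ∂lebesgueOn S = 1 := by
    have := hM.integral_eq h1 ht (ac θ) (st θ) fun _ => 1
    simpa using this.symm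
  have hB0 : 0 ≤ B := (abs_nonneg _).trans (hfB x₀)
  obtain ⟨g, hg, hgr, hfg⟩ := hf.exists_ae_eq_range_subset (t := Set.Icc (-B) B)
    (Filter.Eventually.of_forall fun y => abs_le.1 (hfB y)) (Set.nonempty_Icc.2 (by linarith))
  obtain ⟨Φ, h2, h3, h4⟩ := exists_integrable_dominating_selfNormalized (f := g) (B := B)
    (k := fun y x => p (t + 1) (b t) y x) (p := pT) (ρ := ρ) (lam := lebesgueOn S) (κ := κ)
    (δ := δ) (Λ := Λ) hT hint t₀ hN (fun n => hXm n t ht.le) (fun n => hXm n (t + 1) ht) hind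
    (fun n => hX.map_eq n ht.le)
    (hpm.comp (measurable_const.prodMk measurable_id)) hδ hΛ (hM.lower _ h1 ht _)
    (hM.upper _ h1 ht _) hYlaw
    (fun θ => hM.measurable_density _ h1 ht _ _)
    (fun θ y => hδ.trans_le (hM.lower _ h1 ht _ _ _))
        (fun θ y => hM.upper _ h1 ht _ _ _) hp1 hκ hlip
    hg fun y => abs_le.2 (hgr ⟨y, rfl⟩)
  refine ⟨Φ, h2, ?_, h4.trans ?_⟩
  · have hfgX : ∀ᵐ ω ∂μ, ∀ n, f (X n (t + 1) ω) = g (X n (t + 1) ω) := by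
      rw [ae_all_iff]
      intro n
      refine ae_of_ae_map (p := fun y => f y = g y) (hXm n (t + 1) ht).aemeasurable ?_
      rw [hYlaw n]
      exact (withDensity_absolutelyContinuous _ _).ae_le hfg
    filter_upwards [h3, hfgX] with ω hω hfω x a
    have h5 := hω ⟨WithLp.toLp 2 ((x : EuclideanSpace ℝ (Fin dS)), (a : EuclideanSpace ℝ (Fin dA))),
      x.2, a.2⟩
    have h6 : ∫ y, f y ∂M.P (t + 1) (x, a) = ∫ y, g y * p (t + 1) a y x ∂lebesgueOn S := by
      rw [← hM.integral_eq h1 ht]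
      exact integral_congr_ae ((hM.absolutelyContinuous h1 ht _).ae_le hfg)
    rw [h6]
    simp only [meshExpect, meshWeight, meshRatio, hfω]
    exact h5
  · have hs2 : √2 ≤ 10 / 7 := by
      rw [Real.sqrt_le_left (by norm_num)]; norm_num
    have h7 : κ * dudleyIntegral T ≤ 10 / 7 * (L * dudleyIntegral T + Λ) := by
      have h8 : Λ / (dudleyIntegral T + 1) * dudleyIntegral T ≤ Λ := by
        rw [div_mul_eq_mul_div, div_le_iff₀ (by positivity)]
        nlinarith
      rw [hκdef, mul_assoc, add_mul]
      exact mul_le_mul hs2 (by linarith) (by positivity) (by norm_num)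
    have h9 : 42 * κ * dudleyIntegral T / δ ≤ 60 * ((L * dudleyIntegral T + Λ) / δ) := by
      rw [← mul_div_assoc]
      exact div_le_div_of_nonneg_right (by linarith) hδ.le
    have h10 : Λ / δ ≤ (L * dudleyIntegral T + Λ) / δ :=
      div_le_div_of_nonneg_right (le_add_of_nonneg_left (by positivity)) hδ.le
    have h11 : 0 ≤ Λ ^ 2 / δ ^ 2 := by positivity
    rw [mul_left_comm, mul_left_comm (126 : ℝ)]
    refine mul_le_mul_of_nonneg_left ?_ (by positivity)
    rw [mul_div_assoc 3]
    linarith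

end MDP

end Euclidean

end

/-! ### The error of the mesh algorithm -/

theorem theorem4p1 :
    ∃ C : ℝ, 0 < C ∧ ∃ N₀ : ℕ,
      ∀ (dS dA : ℕ) (S : Set (EuclideanSpace ℝ (Fin dS))) (A : Set (EuclideanSpace ℝ (Fin dA))),
        IsCompact S → IsCompact A →
      ∀ (M : MDP S A) (p : ℕ → A → S → S → ℝ) (ℓ : S → ℝ) (δ Λ L G : ℝ),
        M.IsRegular p ℓ δ Λ L G →
      ∀ (x₀ : S) (b : ℕ → A) (N : ℕ), N₀ < N →
      ∀ (Ω : Type*) [MeasurableSpace Ω] (μ : Measure Ω) [IsProbabilityMeasure μ]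
        (X : Fin N → ℕ → Ω → S), M.IsMeshSample b x₀ μ X →
        Integrable (fun ω => M.meshValue p b (fun n h => X n h ω) x₀ - M.optimalValue x₀) μ ∧
        ∫ ω, |M.meshValue p b (fun n h => X n h ω) x₀ - M.optimalValue x₀| ∂μ ≤
          C * ((M.H : ℝ) ^ 2 * G / √(N : ℝ) *
            ((L * dudleyIntegral (euclideanProd S A) + L * Metric.diam S * Metric.diam A + Λ) / δ
              + Λ ^ 2 / δ ^ 2)) := by
  refine ⟨126, by norm_num, 1, ?_⟩
  intro dS dA S A hS hA M p ℓ δ Λ L G hM x₀ b N hN Ω _ μ _ X hX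
  have hfin := isFiniteMeasure_lebesgueOn hS
  have hSp : PolishSpace S := hS.isClosed.polishSpace
  have hAp : PolishSpace A := hA.isClosed.polishSpace
  have : Nonempty A := ⟨b 0⟩
  have hδ := hM.delta_pos
  have hG : 0 ≤ G := (abs_nonneg _).trans (hM.terminal x₀)
  let ν : Measure S := lebesgueOn S + Measure.dirac x₀
  have hP (t : ℕ) (h1 : 1 ≤ t) (hH : t ≤ M.H) (z : S × A) : M.P t z ≪ ν :=
    (hM.absolutelyContinuous h1 hH z).trans (Measure.le_add_right le_rfl).absolutelyContinuous
  have hx : Measure.dirac x₀ ≪ ν := (Measure.le_add_left le_rfl).absolutelyContinuous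
  have hopt : M.optimalValue x₀ = M.dpValueAux M.H x₀ :=
    MDP.optimalValue_eq_dpValue hP hx hM.reward hM.terminal hG
  set D : ℝ := (L * dudleyIntegral (euclideanProd S A) + Λ) / δ + Λ ^ 2 / δ ^ 2 with hD
  have hstep (t : ℕ) : ∃ Φ : Ω → ℝ, t < M.H → Integrable Φ μ ∧
      (∀ᵐ ω ∂μ, ∀ x a, |MDP.meshExpect p b (fun n h => X n h ω) t (M.dpValue (t + 1)) x a -
        ∫ y, M.dpValue (t + 1) y ∂M.P (t + 1) (x, a)| ≤ Φ ω) ∧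
      ∫ ω, Φ ω ∂μ ≤ 126 * (M.H * G / √N * D) := by
    by_cases ht : t < M.H
    · have hV : AEMeasurable (M.dpValue (t + 1)) (lebesgueOn S) :=
        (MDP.aemeasurable_dpValue hP hM.reward hM.terminal hG ht).mono_ac
          (Measure.le_add_right le_rfl).absolutelyContinuous
      have hb (y : S) : |M.dpValue (t + 1) y| ≤ M.H * G := by
        refine (MDP.abs_dpValueAux_le hM.reward hM.terminal (Nat.sub_le _ _) y).trans ?_
        have : ((M.H - (t + 1) : ℕ) : ℝ) + 1 ≤ M.H := by
          exact_mod_cast (by omega : M.H - (t + 1) + 1 ≤ M.H)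
        gcongr
      obtain ⟨Φ, h⟩ := MDP.exists_integrable_dominating_meshExpect hS hA hM hN hX ht hV hb
      exact ⟨Φ, fun _ => h⟩
    · exact ⟨fun _ => 0, fun h => absurd h ht⟩
  choose Φ hΦ using hstep
  have hΦi : Integrable (fun ω => ∑ t ∈ Finset.range M.H, Φ t ω) μ :=
    integrable_finsetSum _ fun t ht => (hΦ t (Finset.mem_range.1 ht)).1
  have hbound : ∀ᵐ ω ∂μ, |M.meshValue p b (fun n h => X n h ω) x₀ - M.optimalValue x₀| ≤
      ∑ t ∈ Finset.range M.H, Φ t ω := by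
    have hall : ∀ᵐ ω ∂μ, ∀ t, t < M.H → ∀ x a,
        |MDP.meshExpect p b (fun n h => X n h ω) t (M.dpValue (t + 1)) x a -
          ∫ y, M.dpValue (t + 1) y ∂M.P (t + 1) (x, a)| ≤ Φ t ω := by
      rw [ae_all_iff]
      intro t
      by_cases ht : t < M.H
      · filter_upwards [(hΦ t ht).2.1] with ω hω _ using hω
      · exact Filter.Eventually.of_forall fun ω h => absurd h ht
    filter_upwards [hall] with ω hω
    have h := MDP.abs_meshValueAux_sub_dpValueAux_le hN hδ hM.lower hM.reward hM.terminal
      (fun n h => X n h ω) hω le_rfl x₀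
    rw [hopt, MDP.meshValue]
    refine h.trans (le_of_eq ?_)
    rw [← Finset.sum_range_reflect (fun t => Φ t ω)]
    exact Finset.sum_congr rfl fun j _ => by rw [Nat.sub_sub, Nat.add_comm 1 j]
  have hmeas : AEMeasurable (fun ω => M.meshValue p b (fun n h => X n h ω) x₀) μ := by
    -- Times after the horizon carry no information, and `X n h` need not be measurable there.
    let X' : Ω → Fin N → ℕ → S := fun ω n h => if h ≤ M.H then X n h ω else x₀
    have hX' : Measurable X' := by
      refine measurable_pi_iff.2 fun n => measurable_pi_iff.2 fun h => ?_
      by_cases hh : h ≤ M.H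
      · simpa only [X', if_pos hh] using hX.measurable n h hh
      · simpa only [X', if_neg hh] using measurable_const
    have h1 : (fun ω => M.meshValue p b (fun n h => X n h ω) x₀) =
        (fun s => M.meshValueAux p b s M.H x₀) ∘ X' := by
      funext ω
      refine congrFun (MDP.meshValueAux_congr (fun n t ht => ?_) le_rfl) x₀
      simp only [X', if_pos ht]
    rw [h1]
    exact (MDP.aemeasurable_meshValueAux hN hδ
      (fun t h1 hH => hM.measurable_uncurry h1 hH) hM.lower hM.reward hM.terminal hG (μ.map X')
      le_rfl measurable_const).comp_measurable hX'
  have hint : Integrable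
      (fun ω => M.meshValue p b (fun n h => X n h ω) x₀ - M.optimalValue x₀) μ :=
    hΦi.mono' (hmeas.sub_const _).aestronglyMeasurable hbound
  refine ⟨hint, (integral_mono_ae hint.abs hΦi hbound).trans ?_⟩
  rw [integral_finsetSum _ fun t ht => (hΦ t (Finset.mem_range.1 ht)).1]
  refine (Finset.sum_le_card_nsmul _ _ _ fun t ht => (hΦ t (Finset.mem_range.1 ht)).2.2).trans ?_
  have hDle : D ≤ (L * dudleyIntegral (euclideanProd S A) + L * Metric.diam S * Metric.diam A + Λ)
      / δ + Λ ^ 2 / δ ^ 2 := by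
    have : 0 ≤ L * Metric.diam S * Metric.diam A :=
      mul_nonneg (mul_nonneg hM.L_nonneg Metric.diam_nonneg) Metric.diam_nonneg
    rw [hD]
    gcongr
    linarith
  rw [Finset.card_range, nsmul_eq_mul]
  calc (M.H : ℝ) * (126 * (M.H * G / √N * D)) = 126 * ((M.H : ℝ) ^ 2 * G / √N * D) := by ring
    _ ≤ _ := by gcongr
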